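/- Consider the system $\dot x=f(x)$, $y=h(x)$ with state $x\in\mathbb R^n$ and output $y\in\mathbb R^p$, where everything below is expressed in one fixed system of coordinates $x$ of $\mathbb R^n$. Let $\Omega\subset\mathbb R^n$ be open, let $f$ and $h$ be $C^1$ on $\Omega$, and let $Q$ be a continuous symmetric contravariant $2$-tensor on $\Omega$, i.e. $Q(x)$ is a symmetric $n\times n$ matrix depending continuously on $x\in\Omega$. Assume: (i) $\Omega$ is backward invariant: for each $x\in\Omega$ the solution $t\mapsto X(x,t)$ of $\dot x=f(x)$ with $X(x,0)=x$ is defined, with values in $\Omega$, for all $t\le 0$. Moreover the family of linear time-varying systems $\dot\xi=A_x(t)\xi$, $\eta=C_x(t)\xi$, where $A_x(t)=\frac{\partial f}{\partial x}(X(x,t))$ and $C_x(t)=\frac{\partial h}{\partial x}(X(x,t))$, is reconstructible on $\Omega$: there exist real numbers $\tau>0$ and $\varepsilon>0$ such that $$\int_{-\tau}^0\Phi_x(t,0)^\top C_x(t)^\top C_x(t)\Phi_x(t,0)\,dt\;\ge\;\varepsilon I\qquad\forall x\in\Omega,$$ where $\Phi_x$ is the state transition matrix: $\frac{\partial\Phi_x}{\partial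 t}(t,s)=A_x(t)\Phi_x(t,s)$, $\Phi_x(s,s)=I$. (ii) The Jacobian matrices $\frac{\partial f}{\partial x}$ and $\frac{\partial h}{\partial x}$ are bounded on $\Omega$, and there are real numbers $\underline q,\overline q$ with $0<\underline q I\le Q(x)\le\overline q I$ for all $x\in\Omega$. Then there exists a continuous symmetric covariant $2$-tensor $P$ on $\Omega$ (a symmetric $n\times n$ matrix $P(x)$ depending continuously on $x$) which at every point of $\Omega$ admits a Lie derivative $\mathcal L_fP$ along $f$, meaning that $\mathcal L_fP(x)$ is the symmetric matrix such that $$v^\top\mathcal L_fP(x)v=\lim_{t\to0}\frac{\big[(I+t\tfrac{\partial f}{\partial x}(x))v\big]^\top P(X(x,t))\big[(I+t\tfrac{\partial f}{\partial x}(x))v\big]-v^\top P(x)v}{t}\qquad\forall v\in\mathbb R^n ,$$ and this Lie derivative satisfies $$\mathcal L_fP(x)=dh(x)\otimes dh(x)-P(x)Q(x)P(x)\qquad\forall x\in\Omega,$$ where $dh(x)\otimes dh(x)=\frac{\partial h}{\partial x}(x)^\top\frac{\partial h}{\partial x}(x)$. Moreover there exist real numbers $\underline p,\overline p>0$ such that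 $$0<\underline p\,I\le P(x)\le\overline p\,I\qquad\forall x\in\Omega .$$ -/

import Mathlib

open Filter Topology Matrix

noncomputable section

/-- The Jacobian matrix `∂g/∂x (x)` of a map `g : ℝⁿ → ℝᵐ`: its entry `(k, j)` is `∂gₖ/∂xⱼ (x)`. -/
def jacobian {n m : ℕ} (g : (Fin n → ℝ) → (Fin m → ℝ)) (x : Fin n → ℝ) :
    Matrix (Fin m) (Fin n) ℝ :=
  LinearMap.toMatrix' (fderiv ℝ g x).toLinearMap

/-- The symmetric covariant 2-tensor `dh ⊗ dh`, whose entry `(i, j)` in the coordinates `x` is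
`∑ₖ ∂hₖ/∂xᵢ (x) ∂hₖ/∂xⱼ (x)`. -/
def dhTensor {n p : ℕ} (h : (Fin n → ℝ) → (Fin p → ℝ)) (x : Fin n → ℝ) :
    Matrix (Fin n) (Fin n) ℝ :=
  (jacobian h x)ᵀ * jacobian h x

/-- The inequalities `a I ≤ M ≤ b I` between symmetric matrices. -/
def LoewnerBetween {n : ℕ} (a b : ℝ) (M : Matrix (Fin n) (Fin n) ℝ) : Prop :=
  (M - a • (1 : Matrix (Fin n) (Fin n) ℝ)).PosSemidef ∧
    (b • (1 : Matrix (Fin n) (Fin n) ℝ) - M).PosSemidef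

/-- `X` is, on `(-∞, 0]`, a solution of `ẋ = f(x)` with `X(0) = x` and with values in `Ω`. -/
def IsBackwardSolution {n : ℕ} (f : (Fin n → ℝ) → (Fin n → ℝ)) (Ω : Set (Fin n → ℝ))
    (x : Fin n → ℝ) (X : ℝ → (Fin n → ℝ)) : Prop :=
  X 0 = x ∧ IsIntegralCurveOn X (fun _ => f) (Set.Iic 0) ∧ ∀ t ∈ Set.Iic (0 : ℝ), X t ∈ Ω

/-- `Ω` is backward invariant for `ẋ = f(x)`: from each point of `Ω` there starts a solution
which is defined, and stays in `Ω`, for all negative times. -/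
def BackwardInvariant {n : ℕ} (f : (Fin n → ℝ) → (Fin n → ℝ)) (Ω : Set (Fin n → ℝ)) : Prop :=
  ∀ x ∈ Ω, ∃ X : ℝ → (Fin n → ℝ), IsBackwardSolution f Ω x X

/-- `t ↦ Φ t` is, for `t ≤ 0`, the state transition matrix `Φ(t, 0)` of `ξ̇ = A(t) ξ`. -/
def IsTransitionMatrix {n : ℕ} (A : ℝ → Matrix (Fin n) (Fin n) ℝ)
    (Φ : ℝ → Matrix (Fin n) (Fin n) ℝ) : Prop :=
  Φ 0 = 1 ∧ ∀ t ∈ Set.Iic (0 : ℝ), ∀ i j : Fin n,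
    HasDerivWithinAt (fun s => Φ s i j) ((A t * Φ t) i j) (Set.Iic 0) t

/-- The matrix `∫_{-τ}^0 Φ(t)ᵀ C(t)ᵀ C(t) Φ(t) dt`. -/
def gramian {n p : ℕ} (C : ℝ → Matrix (Fin p) (Fin n) ℝ) (Φ : ℝ → Matrix (Fin n) (Fin n) ℝ)
    (τ : ℝ) : Matrix (Fin n) (Fin n) ℝ :=
  Matrix.of fun i j => ∫ t in (-τ)..0, ((Φ t)ᵀ * (C t)ᵀ * C t * Φ t) i j

/-- The family of linearizations `A_x(t) = ∂f/∂x (X(x,t))`, `C_x(t) = ∂h/∂x (X(x,t))` along the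
solutions is reconstructible on `Ω`, with `τ` and `ε` independent of `x`. -/
def Reconstructible {n p : ℕ} (f : (Fin n → ℝ) → (Fin n → ℝ)) (h : (Fin n → ℝ) → (Fin p → ℝ))
    (Ω : Set (Fin n → ℝ)) : Prop :=
  ∃ τ ε : ℝ, 0 < τ ∧ 0 < ε ∧ ∀ x ∈ Ω, ∀ X : ℝ → (Fin n → ℝ), IsBackwardSolution f Ω x X →
    ∃ Φ : ℝ → Matrix (Fin n) (Fin n) ℝ,
      IsTransitionMatrix (fun t => jacobian f (X t)) Φ ∧
      (gramian (fun t => jacobian h (X t)) Φ τ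
        - ε • (1 : Matrix (Fin n) (Fin n) ℝ)).PosSemidef

/-- `P` admits at `x` a Lie derivative along `f`, equal to the symmetric matrix `L`: with `X` the
local solution of `ẋ = f(x)` from `x`, and for every `v`,
`vᵀ L v = lim_{t → 0} ([(I + t ∂f/∂x(x)) v]ᵀ P(X(t)) [(I + t ∂f/∂x(x)) v] - vᵀ P(x) v) / t`. -/
def HasLieDerivativeAt {n : ℕ} (f : (Fin n → ℝ) → (Fin n → ℝ))
    (P : (Fin n → ℝ) → Matrix (Fin n) (Fin n) ℝ) (L : Matrix (Fin n) (Fin n) ℝ)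
    (x : Fin n → ℝ) : Prop :=
  L.IsSymm ∧
  (∃ X : ℝ → (Fin n → ℝ), X 0 = x ∧ IsIntegralCurveAt X (fun _ => f) 0) ∧
  ∀ X : ℝ → (Fin n → ℝ), X 0 = x → IsIntegralCurveAt X (fun _ => f) 0 →
    ∀ v : Fin n → ℝ,
      Tendsto
        (fun t : ℝ =>
          (((1 + t • jacobian f x) *ᵥ v) ⬝ᵥ (P (X t) *ᵥ ((1 + t • jacobian f x) *ᵥ v))
            - v ⬝ᵥ (P x *ᵥ v)) / t)
        (𝓝[≠] 0) (𝓝 (v ⬝ᵥ (L *ᵥ v)))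

end

/-!
The tensor `P` is the bounded solution of a Riccati equation. Along a backward solution
`t ↦ X(x, t)`, with `A = ∂f/∂x`, `W = dh ⊗ dh` and `Q` evaluated on the solution, the required
identity says that `t ↦ P(X(x, t))` solves `R' = W - Aᵀ R - R A - R Q R`. Let `R_s(t)` be the
solution of this equation with `R_s(s) = 0`; then `P(x) = lim R_s(0)` as `s → -∞`.

Everything is read off from the Hamiltonian system `ξ' = A ξ + Q π`, `π' = W ξ - Aᵀ π`: the operator
`R_s(t)` sends `ξ(t)` to `π(t)` for the solutions with `π(s) = 0` (`RiccatiCoeff.IsValueOp`). The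
symplectic form `⟪π₁, ξ₂⟫ - ⟪ξ₁, π₂⟫` of two solutions is constant, which gives uniqueness and
symmetry of `R_s(t)`, and the energy `⟪π, ξ⟫` has derivative `⟪W ξ, ξ⟫ + ⟪Q π, π⟫ ≥ 0`.

* Existence (`BoundedOn.exists_valueFlow`): the Hamiltonian system is linear, hence globally
  solvable, and a backward Grönwall estimate for `ξ` in terms of the energy shows that the state
  component of the fundamental solution is invertible.
* Bounds: `⟪R_s(t) v, v⟫` is at most the cost of the competitor `r ↦ exp(r - t) v`
  (`IsHamPair.energy_le`), and for `t - s ≥ τ` reconstructibility bounds it from below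
  (`IsHamPair.le_energy`).
* Contraction (`IsValueOp.norm_sub_le`): by these bounds the energy, hence `ξ`, decays exponentially
  backward in time, so the symplectic form of two solutions evaluated far in the past shows that
  `R_s(t) - R_{s'}(t)` is exponentially small, uniformly in the base point. The limit exists, and it
  satisfies the Riccati equation because the derivatives converge too.
* Continuity in `x`: the derivative of the symplectic form of solutions for two different sets of
  coefficients shows that `R_s(0)` is Lipschitz in the coefficients
  (`IsValueOp.norm_sub_le_of_coeff`); these depend continuously on `x`, uniformly on compact time
  intervals, by a tube argument for the flow (`exists_tube_norm_sub_le`). The limit is uniform in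
  `x`.

For the Lie derivative at `x`, which involves times of both signs, `x` is regarded as a point in the
interior of the backward solution from a later point of its own orbit.
-/

/-! ### Linear differential equations on a compact interval -/

section LinearODE

open Set Metric
open scoped NNReal

/-- A function with nonnegative one-sided derivatives on `[a, b]` satisfies `φ a ≤ φ b`. -/
theorem le_of_hasDerivWithinAt_Icc_nonneg {φ φ' : ℝ → ℝ} {a b : ℝ} (hab : a ≤ b)
    (hφ : ∀ r ∈ Icc a b, HasDerivWithinAt φ (φ' r) (Icc a b) r)
    (hφ' : ∀ r ∈ Icc a b, 0 ≤ φ' r) : φ a ≤ φ b := by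
  have hmono : MonotoneOn φ (Icc a b) :=
    monotoneOn_of_hasDerivWithinAt_nonneg (f' := φ') (convex_Icc a b)
      (fun r hr => (hφ r hr).continuousWithinAt)
      (fun r hr => (hφ r (interior_subset hr)).mono interior_subset)
      (fun r hr => hφ' r (interior_subset hr))
  exact hmono (left_mem_Icc.2 hab) (right_mem_Icc.2 hab) hab

variable {F : Type*} [NormedAddCommGroup F] [NormedSpace ℝ F]

/-- Radial truncation to the ball of radius `R`: the identity on the ball, with values in it. -/
noncomputable def radialTrunc (R : ℝ) (z : F) : F := (R / max R ‖z‖) • z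

theorem radialTrunc_of_norm_le {R : ℝ} (hR : 0 < R) {z : F} (hz : ‖z‖ ≤ R) :
    radialTrunc R z = z := by
  rw [radialTrunc, max_eq_left hz, div_self hR.ne', one_smul]

theorem norm_radialTrunc_le {R : ℝ} (hR : 0 < R) (z : F) :
    ‖radialTrunc R z‖ ≤ R ∧ ‖radialTrunc R z‖ ≤ ‖z‖ := by
  have hm : 0 < max R ‖z‖ := lt_max_of_lt_left hR
  rw [radialTrunc, norm_smul, Real.norm_of_nonneg (by positivity)]
  constructor
  · rw [div_mul_eq_mul_div, div_le_iff₀ hm]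
    gcongr
    exact le_max_right _ _
  · have : R / max R ‖z‖ ≤ 1 := by
      rw [div_le_one hm]
      exact le_max_left _ _
    nlinarith [norm_nonneg z]

theorem norm_radialTrunc_sub_le {R : ℝ} (hR : 0 < R) (z w : F) :
    ‖radialTrunc R z - radialTrunc R w‖ ≤ 2 * ‖z - w‖ := by
  have hz : 0 < max R ‖z‖ := lt_max_of_lt_left hR
  have hw : 0 < max R ‖w‖ := lt_max_of_lt_left hR
  have hsplit : radialTrunc R z - radialTrunc R w
      = (R / max R ‖z‖) • (z - w) + (R / max R ‖z‖ - R / max R ‖w‖) • w := by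
    simp only [radialTrunc]
    module
  have h1 : ‖(R / max R ‖z‖) • (z - w)‖ ≤ ‖z - w‖ := by
    rw [norm_smul, Real.norm_of_nonneg (by positivity)]
    have : R / max R ‖z‖ ≤ 1 := by
      rw [div_le_one hz]
      exact le_max_left _ _
    nlinarith [norm_nonneg (z - w)]
  have h2 : ‖(R / max R ‖z‖ - R / max R ‖w‖) • w‖ ≤ ‖z - w‖ := by
    have hd : R / max R ‖z‖ - R / max R ‖w‖
        = (R / max R ‖z‖) * ((max R ‖w‖ - max R ‖z‖) / max R ‖w‖) := by
      field_simp
    have habs : |max R ‖w‖ - max R ‖z‖| ≤ ‖z - w‖ := by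
      rw [max_comm R, max_comm R, abs_sub_comm]
      exact (abs_max_sub_max_le_abs ‖z‖ ‖w‖ R).trans (abs_norm_sub_norm_le z w)
    rw [norm_smul, hd, Real.norm_eq_abs, abs_mul,
      abs_of_nonneg (by positivity : 0 ≤ R / max R ‖z‖), abs_div, abs_of_pos hw]
    have h3 : R / max R ‖z‖ ≤ 1 := by
      rw [div_le_one hz]
      exact le_max_left _ _
    have h4 : ‖w‖ / max R ‖w‖ ≤ 1 := by
      rw [div_le_one hw]
      exact le_max_right _ _
    calc R / max R ‖z‖ * (|max R ‖w‖ - max R ‖z‖| / max R ‖w‖) * ‖w‖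
        = (R / max R ‖z‖) * (‖w‖ / max R ‖w‖) * |max R ‖w‖ - max R ‖z‖| := by ring
      _ ≤ 1 * 1 * ‖z - w‖ := by gcongr
      _ = ‖z - w‖ := by ring
  rw [hsplit]
  linarith [norm_add_le ((R / max R ‖z‖) • (z - w)) ((R / max R ‖z‖ - R / max R ‖w‖) • w)]

/-- A globally Lipschitz, time-continuous vector field vanishing at the origin has a solution on
the whole of `[a, b]`. The field is truncated outside a ball to make the Picard–Lindelöf theorem
applicable on the whole interval; by Grönwall's inequality the solution never leaves the ball. -/
theorem exists_solution_Icc_of_lipschitz [CompleteSpace F] {f : ℝ → F → F} {a b : ℝ} (hab : a ≤ b)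
    {K : ℝ≥0} (hlip : ∀ t ∈ Icc a b, LipschitzWith K (f t)) (hzero : ∀ t ∈ Icc a b, f t 0 = 0)
    (hcont : ∀ z, ContinuousOn (fun t => f t z) (Icc a b)) (z₀ : F) :
    ∃ α : ℝ → F, α a = z₀ ∧
      ∀ t ∈ Icc a b, HasDerivWithinAt α (f t (α t)) (Icc a b) t := by
  set R : ℝ := (‖z₀‖ + 1) * Real.exp (K * (b - a)) with hRdef
  have hR : 0 < R := by positivity
  have hfn : ∀ t ∈ Icc a b, ∀ z, ‖f t z‖ ≤ K * ‖z‖ := fun t ht z => by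
    simpa [hzero t ht] using (hlip t ht).norm_sub_le z 0
  have hba : 0 ≤ b - a := sub_nonneg.2 hab
  have hPL : IsPicardLindelof (fun t z => f t (radialTrunc R z)) (⟨a, left_mem_Icc.2 hab⟩ : Icc a b)
      z₀ (K * ⟨R, hR.le⟩ * ⟨b - a, hba⟩) 0 (K * ⟨R, hR.le⟩) (K * 2) := by
    refine ⟨fun t ht => ?_, fun z _ => hcont _, fun t ht z _ => ?_, ?_⟩
    · refine ((hlip t ht).comp (?_ : LipschitzWith 2 (radialTrunc R))).lipschitzOnWith
      exact LipschitzWith.of_dist_le_mul fun z w => by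
        simpa [dist_eq_norm] using norm_radialTrunc_sub_le hR z w
    · refine (hfn t ht _).trans ?_
      exact mul_le_mul_of_nonneg_left (norm_radialTrunc_le hR z).1 K.2
    · change (K : ℝ) * R * max (b - a) (a - a) ≤ K * R * (b - a) - 0
      rw [sub_self, sub_zero, max_eq_left hba]
  obtain ⟨α, hα0, hα⟩ := hPL.exists_eq_forall_mem_Icc_hasDerivWithinAt₀
  have hα0 : α a = z₀ := hα0
  have hbound : ∀ t ∈ Icc a b, ‖α t‖ ≤ R := by
    intro t ht
    have := norm_le_gronwallBound_of_norm_deriv_right_le (f := α) (δ := ‖z₀‖ + 1) (K := K) (ε := 0)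
      (fun t ht => (hα t ht).continuousWithinAt)
      (fun r hr => (hα r (Ico_subset_Icc_self hr)).mono_of_mem_nhdsWithin (Icc_mem_nhdsGE_of_mem hr))
      (by rw [hα0]; linarith) (fun r hr => by
        have h1 := hfn r (Ico_subset_Icc_self hr) (radialTrunc R (α r))
        have h2 := mul_le_mul_of_nonneg_left (norm_radialTrunc_le hR (α r)).2 K.2
        have h3 : (K : ℝ) * ‖radialTrunc R (α r)‖ ≤ K * ‖α r‖ := h2
        linarith) t ht
    rw [gronwallBound_ε0] at this
    refine this.trans ?_
    rw [hRdef]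
    have := ht.2
    gcongr
  refine ⟨α, hα0, fun t ht => ?_⟩
  have := hα t ht
  rwa [radialTrunc_of_norm_le hR (hbound t ht)] at this

end LinearODE

/-! ### The Hamiltonian system of a Riccati equation -/

open Set
open scoped RealInnerProductSpace

/-- The coefficients of the Riccati equation `R' = W - A† R - R A - R Q R` and of the associated
Hamiltonian system `ξ' = A ξ + Q π`, `π' = W ξ - A† π`. -/
structure RiccatiCoeff (E : Type*) [NormedAddCommGroup E] [InnerProductSpace ℝ E] where
  /-- The matrix of the linearized dynamics. -/
  A : ℝ → E →L[ℝ] E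
  /-- The output weight. -/
  W : ℝ → E →L[ℝ] E
  /-- The weight of the quadratic term. -/
  Q : ℝ → E →L[ℝ] E

namespace RiccatiCoeff

variable {E : Type*} [NormedAddCommGroup E] [InnerProductSpace ℝ E]

/-- Continuity, symmetry and uniform bounds on a set of times: `‖A‖ ≤ a`, `0 ≤ W ≤ c`, and
`q ≤ Q` with `‖Q‖ ≤ b`. -/
structure BoundedOn (H : RiccatiCoeff E) (a c q b : ℝ) (J : Set ℝ) : Prop where
  a_nonneg : 0 ≤ a
  c_nonneg : 0 ≤ c
  q_pos : 0 < q
  b_nonneg : 0 ≤ b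
  continuousOn_A : ContinuousOn H.A J
  continuousOn_W : ContinuousOn H.W J
  continuousOn_Q : ContinuousOn H.Q J
  norm_A_le : ∀ r ∈ J, ‖H.A r‖ ≤ a
  norm_W_le : ∀ r ∈ J, ‖H.W r‖ ≤ c
  norm_Q_le : ∀ r ∈ J, ‖H.Q r‖ ≤ b
  symm_W : ∀ r ∈ J, ∀ x y, ⟪H.W r x, y⟫ = ⟪x, H.W r y⟫
  symm_Q : ∀ r ∈ J, ∀ x y, ⟪H.Q r x, y⟫ = ⟪x, H.Q r y⟫
  nonneg_W : ∀ r ∈ J, ∀ x, 0 ≤ ⟪H.W r x, x⟫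
  le_Q : ∀ r ∈ J, ∀ x, q * ‖x‖ ^ 2 ≤ ⟪H.Q r x, x⟫

theorem BoundedOn.mono {H : RiccatiCoeff E} {a c q b : ℝ} {J J' : Set ℝ}
    (h : H.BoundedOn a c q b J) (hJ : J' ⊆ J) : H.BoundedOn a c q b J' where
  a_nonneg := h.a_nonneg
  c_nonneg := h.c_nonneg
  q_pos := h.q_pos
  b_nonneg := h.b_nonneg
  continuousOn_A := h.continuousOn_A.mono hJ
  continuousOn_W := h.continuousOn_W.mono hJ
  continuousOn_Q := h.continuousOn_Q.mono hJ
  norm_A_le r hr := h.norm_A_le r (hJ hr)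
  norm_W_le r hr := h.norm_W_le r (hJ hr)
  norm_Q_le r hr := h.norm_Q_le r (hJ hr)
  symm_W r hr := h.symm_W r (hJ hr)
  symm_Q r hr := h.symm_Q r (hJ hr)
  nonneg_W r hr := h.nonneg_W r (hJ hr)
  le_Q r hr := h.le_Q r (hJ hr)

/-- The upper bound for the value operators given by coefficients bounded by `a`, `c`, `q`. -/
noncomputable def upperConst (a c q : ℝ) : ℝ := (c + (1 + a) ^ 2 / q) / 2

theorem BoundedOn.upperConst_pos {H : RiccatiCoeff E} {a c q b : ℝ} {J : Set ℝ}
    (hH : H.BoundedOn a c q b J) : 0 < upperConst a c q := by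
  have := hH.a_nonneg
  have := hH.c_nonneg
  have := hH.q_pos
  unfold upperConst
  positivity

variable [CompleteSpace E]

/-- `(ξ, π)` solves the Hamiltonian system `ξ' = A ξ + Q π`, `π' = W ξ - A† π` on `[s, t]`. -/
structure IsHamSolution (H : RiccatiCoeff E) (s t : ℝ) (ξ π : ℝ → E) : Prop where
  deriv_state : ∀ r ∈ Icc s t, HasDerivWithinAt ξ (H.A r (ξ r) + H.Q r (π r)) (Icc s t) r
  deriv_costate : ∀ r ∈ Icc s t,
    HasDerivWithinAt π (H.W r (ξ r) - (H.A r).adjoint (π r)) (Icc s t) r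

/-- `(ξ, π)` solves the Hamiltonian system on `[s, t]` and `π s = 0`. -/
structure IsHamPair (H : RiccatiCoeff E) (s t : ℝ) (ξ π : ℝ → E) : Prop
    extends H.IsHamSolution s t ξ π where
  costate_left : π s = 0

variable {H : RiccatiCoeff E} {a c q b s t : ℝ} {ξ π ξ₁ π₁ ξ₂ π₂ : ℝ → E}

theorem IsHamSolution.mono (h : H.IsHamSolution s t ξ π) {s' t' : ℝ} (hs : s ≤ s') (ht : t' ≤ t) :
    H.IsHamSolution s' t' ξ π where
  deriv_state x hx := (h.deriv_state x ⟨hs.trans hx.1, hx.2.trans ht⟩).mono (Icc_subset_Icc hs ht)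
  deriv_costate x hx :=
    (h.deriv_costate x ⟨hs.trans hx.1, hx.2.trans ht⟩).mono (Icc_subset_Icc hs ht)

theorem IsHamPair.mono_right (h : H.IsHamPair s t ξ π) {r : ℝ} (hr : r ≤ t) :
    H.IsHamPair s r ξ π :=
  ⟨h.toIsHamSolution.mono le_rfl hr, h.costate_left⟩

/-- Derivative of the symplectic form of two solutions belonging to different coefficients. -/
theorem IsHamSolution.hasDerivWithinAt_symplectic {H₁ H₂ : RiccatiCoeff E}
    (h₁ : H₁.IsHamSolution s t ξ₁ π₁) (h₂ : H₂.IsHamSolution s t ξ₂ π₂)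
    (hW : ∀ r ∈ Icc s t, ∀ x y, ⟪H₂.W r x, y⟫ = ⟪x, H₂.W r y⟫)
    (hQ : ∀ r ∈ Icc s t, ∀ x y, ⟪H₁.Q r x, y⟫ = ⟪x, H₁.Q r y⟫) {r : ℝ} (hr : r ∈ Icc s t) :
    HasDerivWithinAt (fun r => ⟪π₁ r, ξ₂ r⟫ - ⟪ξ₁ r, π₂ r⟫)
      (⟪(H₁.W r - H₂.W r) (ξ₁ r), ξ₂ r⟫ + ⟪π₁ r, (H₂.A r - H₁.A r) (ξ₂ r)⟫
        + ⟪(H₂.A r - H₁.A r) (ξ₁ r), π₂ r⟫ + ⟪π₁ r, (H₂.Q r - H₁.Q r) (π₂ r)⟫) (Icc s t) r := by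
  refine (((h₁.deriv_costate r hr).inner ℝ (h₂.deriv_state r hr)).sub
    ((h₁.deriv_state r hr).inner ℝ (h₂.deriv_costate r hr))).congr_deriv ?_
  simp only [inner_add_left, inner_add_right, inner_sub_left, inner_sub_right,
    ContinuousLinearMap.adjoint_inner_left, ContinuousLinearMap.adjoint_inner_right,
    _root_.sub_apply, hW r hr, hQ r hr]
  ring

/-- The symplectic form of two solutions is constant. -/
theorem IsHamSolution.symplectic_eq (h₁ : H.IsHamSolution s t ξ₁ π₁)
    (h₂ : H.IsHamSolution s t ξ₂ π₂) (hH : H.BoundedOn a c q b (Icc s t)) (hst : s ≤ t) :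
    ⟪π₁ t, ξ₂ t⟫ - ⟪ξ₁ t, π₂ t⟫ = ⟪π₁ s, ξ₂ s⟫ - ⟪ξ₁ s, π₂ s⟫ := by
  have hd : ∀ r ∈ Icc s t, HasDerivWithinAt (fun r => ⟪π₁ r, ξ₂ r⟫ - ⟪ξ₁ r, π₂ r⟫) 0 (Icc s t) r :=
    fun r hr => (h₁.hasDerivWithinAt_symplectic h₂ hH.symm_W hH.symm_Q hr).congr_deriv (by simp)
  have h1 := le_of_hasDerivWithinAt_Icc_nonneg hst hd (fun _ _ => le_rfl)
  have h2 := le_of_hasDerivWithinAt_Icc_nonneg hst (fun r hr => (hd r hr).neg) (by simp)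
  simp only [Pi.neg_apply] at h2
  linarith

theorem IsHamPair.inner_symm (h₁ : H.IsHamPair s t ξ₁ π₁) (h₂ : H.IsHamPair s t ξ₂ π₂)
    (hH : H.BoundedOn a c q b (Icc s t)) (hst : s ≤ t) : ⟪π₁ t, ξ₂ t⟫ = ⟪ξ₁ t, π₂ t⟫ := by
  have h := h₁.symplectic_eq h₂.toIsHamSolution hH hst
  rwa [h₁.costate_left, h₂.costate_left, inner_zero_left, inner_zero_right, sub_zero,
    sub_eq_zero] at h

theorem IsHamPair.hasDerivWithinAt_energy (h : H.IsHamPair s t ξ π) {r : ℝ} (hr : r ∈ Icc s t) :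
    HasDerivWithinAt (fun r => ⟪π r, ξ r⟫) (⟪H.W r (ξ r), ξ r⟫ + ⟪H.Q r (π r), π r⟫)
      (Icc s t) r := by
  refine ((h.deriv_costate r hr).inner ℝ (h.deriv_state r hr)).congr_deriv ?_
  simp only [inner_add_right, inner_sub_left, ContinuousLinearMap.adjoint_inner_left,
    real_inner_comm (π r) (H.Q r (π r))]
  ring

theorem IsHamPair.energy_mono (h : H.IsHamPair s t ξ π) (hH : H.BoundedOn a c q b (Icc s t))
    {r : ℝ} (hr : r ∈ Icc s t) : ⟪π r, ξ r⟫ ≤ ⟪π t, ξ t⟫ := by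
  have hsub : Icc r t ⊆ Icc s t := Icc_subset_Icc_left hr.1
  refine le_of_hasDerivWithinAt_Icc_nonneg hr.2
    (fun x hx => (h.hasDerivWithinAt_energy (hsub hx)).mono hsub) fun x hx => ?_
  have h1 := hH.nonneg_W x (hsub hx) (ξ x)
  have h2 := hH.le_Q x (hsub hx) (π x)
  have h3 := hH.q_pos
  nlinarith [sq_nonneg ‖π x‖]

theorem IsHamPair.energy_nonneg (h : H.IsHamPair s t ξ π) (hH : H.BoundedOn a c q b (Icc s t))
    (hst : s ≤ t) : 0 ≤ ⟪π t, ξ t⟫ := by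
  have := h.energy_mono hH (left_mem_Icc.2 hst)
  rwa [h.costate_left, inner_zero_left] at this

/-- Backward Grönwall estimate: a curve driven by an input bounded by `b ‖π‖` is controlled
backward in time by its final value and the energy of the pair, because the energy grows at
least as fast as `q ‖π‖²`. -/
theorem IsHamPair.norm_sq_le_of_driven (h : H.IsHamPair s t ξ π)
    (hH : H.BoundedOn a c q b (Icc s t)) {r : ℝ} (hr : r ∈ Icc s t) {e u : ℝ → E}
    (he : ∀ x ∈ Icc r t, HasDerivWithinAt e (H.A x (e x) + u x) (Icc r t) x)
    (hu : ∀ x ∈ Icc r t, ‖u x‖ ≤ b * ‖π x‖) :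
    ‖e r‖ ^ 2 ≤ Real.exp ((2 * a + 1) * (t - r)) *
      (‖e t‖ ^ 2 + b ^ 2 / q * (⟪π t, ξ t⟫ - ⟪π r, ξ r⟫)) := by
  set k := 2 * a + 1 with hk
  have hsub : Icc r t ⊆ Icc s t := Icc_subset_Icc_left hr.1
  have hk0 : 0 ≤ k := by have := hH.a_nonneg; positivity
  have key := le_of_hasDerivWithinAt_Icc_nonneg hr.2
    (φ := fun x => Real.exp (k * x) * ‖e x‖ ^ 2 + Real.exp (k * t) * (b ^ 2 / q) * ⟪π x, ξ x⟫)
    (φ' := fun x => (Real.exp (k * x) * k * ‖e x‖ ^ 2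
        + Real.exp (k * x) * (2 * ⟪e x, H.A x (e x) + u x⟫))
      + Real.exp (k * t) * (b ^ 2 / q) * (⟪H.W x (ξ x), ξ x⟫ + ⟪H.Q x (π x), π x⟫))
    (fun x hx => by
      have hexp : HasDerivWithinAt (fun x => Real.exp (k * x)) (Real.exp (k * x) * k) (Icc r t) x :=
        (((hasDerivAt_id x).const_mul k).exp.congr_deriv (by simp)).hasDerivWithinAt
      exact (hexp.mul (he x hx).norm_sq).add
        (((h.hasDerivWithinAt_energy (hsub hx)).mono hsub).const_mul _))
    (fun x hx => by
      have hA : |⟪e x, H.A x (e x)⟫| ≤ a * ‖e x‖ ^ 2 := by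
        refine (abs_real_inner_le_norm _ _).trans ?_
        have := (H.A x).le_of_opNorm_le (hH.norm_A_le x (hsub hx)) (e x)
        nlinarith [norm_nonneg (e x)]
      have hU : |⟪e x, u x⟫| ≤ ‖e x‖ * (b * ‖π x‖) :=
        (abs_real_inner_le_norm _ _).trans
          (mul_le_mul_of_nonneg_left (hu x hx) (norm_nonneg _))
      have hU' : 2 * (‖e x‖ * (b * ‖π x‖)) ≤ ‖e x‖ ^ 2 + b ^ 2 * ‖π x‖ ^ 2 := by
        nlinarith [sq_nonneg (‖e x‖ - b * ‖π x‖)]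
      have h1 := hH.nonneg_W x (hsub hx) (ξ x)
      have h2 := hH.le_Q x (hsub hx) (π x)
      have hq := hH.q_pos
      have h3 : b ^ 2 * ‖π x‖ ^ 2 ≤ b ^ 2 / q * (⟪H.W x (ξ x), ξ x⟫ + ⟪H.Q x (π x), π x⟫) := by
        rw [div_mul_eq_mul_div, le_div_iff₀ hq]
        nlinarith [sq_nonneg b]
      have h4 : -(b ^ 2 * ‖π x‖ ^ 2) ≤ k * ‖e x‖ ^ 2 + 2 * ⟪e x, H.A x (e x) + u x⟫ := by
        rw [inner_add_right]
        have := abs_le.1 hA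
        have := abs_le.1 hU
        nlinarith
      have h5 : Real.exp (k * x) ≤ Real.exp (k * t) :=
        Real.exp_le_exp.2 (mul_le_mul_of_nonneg_left hx.2 hk0)
      have h6 := mul_le_mul_of_nonneg_left h4 (Real.exp_pos (k * x)).le
      have h7 := mul_le_mul_of_nonneg_left h3 (Real.exp_pos (k * t)).le
      have h8 := mul_le_mul_of_nonneg_right h5 (by positivity : 0 ≤ b ^ 2 * ‖π x‖ ^ 2)
      nlinarith)
  have hexp : Real.exp (k * (t - r)) = Real.exp (k * t) / Real.exp (k * r) := by
    rw [← Real.exp_sub]; ring_nf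
  rw [hexp, div_mul_eq_mul_div, le_div_iff₀ (Real.exp_pos _)]
  nlinarith

theorem IsHamPair.norm_sq_state_le (h : H.IsHamPair s t ξ π)
    (hH : H.BoundedOn a c q b (Icc s t)) {r : ℝ} (hr : r ∈ Icc s t) :
    ‖ξ r‖ ^ 2 ≤ Real.exp ((2 * a + 1) * (t - r)) *
      (‖ξ t‖ ^ 2 + b ^ 2 / q * (⟪π t, ξ t⟫ - ⟪π r, ξ r⟫)) := by
  have hsub : Icc r t ⊆ Icc s t := Icc_subset_Icc_left hr.1
  exact h.norm_sq_le_of_driven hH hr (fun x hx => (h.deriv_state x (hsub hx)).mono hsub)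
    (fun x hx => (H.Q x).le_of_opNorm_le (hH.norm_Q_le x (hsub hx)) _)

/-- The energy is bounded above by the cost of the competitor `r ↦ exp (r - t) • ξ t`. -/
theorem IsHamPair.energy_le (h : H.IsHamPair s t ξ π) (hH : H.BoundedOn a c q b (Icc s t))
    (hst : s ≤ t) : ⟪π t, ξ t⟫ ≤ upperConst a c q * ‖ξ t‖ ^ 2 := by
  set M := upperConst a c q with hM
  set v := ξ t with hv
  have hMpos : 0 < M := hH.upperConst_pos
  have hη : ∀ r, HasDerivAt (fun r => Real.exp (r - t) • v) (Real.exp (r - t) • v) r := fun r => by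
    have : HasDerivAt (fun r => Real.exp (r - t)) (Real.exp (r - t)) r :=
      ((hasDerivAt_id r).sub_const t).exp.congr_deriv (by simp)
    exact this.smul_const v
  have key := le_of_hasDerivWithinAt_Icc_nonneg hst
    (φ := fun r => M * ‖Real.exp (r - t) • v‖ ^ 2 - (2 * ⟪π r, Real.exp (r - t) • v⟫ - ⟪π r, ξ r⟫))
    (fun r hr => (((hη r).hasDerivWithinAt.norm_sq).const_mul M).sub
      ((((h.deriv_costate r hr).inner ℝ (hη r).hasDerivWithinAt).const_mul 2).sub
        (h.hasDerivWithinAt_energy hr)))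
    (fun r hr => by
      set η := Real.exp (r - t) • v with hηr
      have hq := hH.q_pos
      have h1 := hH.nonneg_W r hr (ξ r - η)
      have h2 := hH.le_Q r hr (π r)
      have h3 : ⟪H.W r η, η⟫ ≤ c * ‖η‖ ^ 2 := by
        refine (real_inner_le_norm _ _).trans ?_
        have := (H.W r).le_of_opNorm_le (hH.norm_W_le r hr) η
        nlinarith [norm_nonneg η]
      have h4 : |⟪π r, η⟫ - ⟪π r, H.A r η⟫| ≤ ‖π r‖ * ((1 + a) * ‖η‖) := by
        rw [← inner_sub_right]
        refine (abs_real_inner_le_norm _ _).trans ?_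
        refine mul_le_mul_of_nonneg_left ?_ (norm_nonneg _)
        have := (H.A r).le_of_opNorm_le (hH.norm_A_le r hr) η
        have := norm_sub_le η (H.A r η)
        linarith
      have h5 : 2 * (‖π r‖ * ((1 + a) * ‖η‖)) ≤ q * ‖π r‖ ^ 2 + (1 + a) ^ 2 / q * ‖η‖ ^ 2 := by
        have : q * ‖π r‖ ^ 2 + (1 + a) ^ 2 / q * ‖η‖ ^ 2 - 2 * (‖π r‖ * ((1 + a) * ‖η‖))
            = (q * ‖π r‖ - (1 + a) * ‖η‖) ^ 2 / q := by
          field_simp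
          ring
        have : 0 ≤ (q * ‖π r‖ - (1 + a) * ‖η‖) ^ 2 / q := by positivity
        linarith
      have h6 : M * 2 = c + (1 + a) ^ 2 / q := by rw [hM, upperConst]; ring
      have h7 : M * (2 * ⟪η, η⟫) = c * ‖η‖ ^ 2 + (1 + a) ^ 2 / q * ‖η‖ ^ 2 := by
        rw [real_inner_self_eq_norm_sq, ← mul_assoc, h6]; ring
      have h8 := abs_le.1 h4
      rw [h7]
      simp only [inner_sub_left, inner_sub_right, map_sub,
        ContinuousLinearMap.adjoint_inner_left] at h1 ⊢
      have h9 : ⟪H.W r η, ξ r⟫ = ⟪H.W r (ξ r), η⟫ := by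
        rw [hH.symm_W r hr, real_inner_comm]
      linarith)
  have h0 : 0 ≤ M * ‖Real.exp (s - t) • v‖ ^ 2 := by positivity
  simp only [h.costate_left, inner_zero_left, sub_self, Real.exp_zero, one_smul] at key
  rw [← hv] at key
  linarith

end RiccatiCoeff

/-! ### Value operators and the Riccati equation -/

namespace RiccatiCoeff

variable {E : Type*} [NormedAddCommGroup E] [InnerProductSpace ℝ E] [CompleteSpace E]
  {H : RiccatiCoeff E} {a c q b s t : ℝ} {ξ π : ℝ → E}

/-- `R` maps the final state to the final costate for all solutions of the Hamiltonian system on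
`[s, t]` with vanishing initial costate, and every final state occurs. In other words, `R` is the
value at time `t` of the solution of the Riccati equation starting from `0` at time `s`. -/
def IsValueOp (H : RiccatiCoeff E) (s t : ℝ) (R : E →L[ℝ] E) : Prop :=
  ∀ v, ∃ ξ π : ℝ → E, H.IsHamPair s t ξ π ∧ ξ t = v ∧ π t = R v

theorem IsValueOp.inner_symm {R : E →L[ℝ] E} (hR : H.IsValueOp s t R)
    (hH : H.BoundedOn a c q b (Icc s t)) (hst : s ≤ t) (v w : E) : ⟪R v, w⟫ = ⟪v, R w⟫ := by
  obtain ⟨ξ, π, h, hξ, hπ⟩ := hR v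
  obtain ⟨ξ', π', h', hξ', hπ'⟩ := hR w
  rw [← hπ, ← hξ, ← hπ', ← hξ']
  exact h.inner_symm h' hH hst

/-- A value operator relates final state and costate of every solution, by the vanishing of the
symplectic form. -/
theorem IsValueOp.apply_eq {R : E →L[ℝ] E} (hR : H.IsValueOp s t R)
    (hH : H.BoundedOn a c q b (Icc s t)) (hst : s ≤ t) (h : H.IsHamPair s t ξ π) :
    R (ξ t) = π t := by
  refine ext_inner_right ℝ fun w => ?_
  obtain ⟨ξ', π', h', hξ', hπ'⟩ := hR w
  rw [hR.inner_symm hH hst, ← hπ', ← hξ']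
  exact (h.inner_symm h' hH hst).symm

theorem IsValueOp.inner_nonneg {R : E →L[ℝ] E} (hR : H.IsValueOp s t R)
    (hH : H.BoundedOn a c q b (Icc s t)) (hst : s ≤ t) (v : E) : 0 ≤ ⟪R v, v⟫ := by
  obtain ⟨ξ, π, h, rfl, hπ⟩ := hR v
  rw [← hπ]
  exact h.energy_nonneg hH hst

theorem IsValueOp.inner_le {R : E →L[ℝ] E} (hR : H.IsValueOp s t R)
    (hH : H.BoundedOn a c q b (Icc s t)) (hst : s ≤ t) (v : E) :
    ⟪R v, v⟫ ≤ upperConst a c q * ‖v‖ ^ 2 := by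
  obtain ⟨ξ, π, h, rfl, hπ⟩ := hR v
  rw [← hπ]
  exact h.energy_le hH hst

end RiccatiCoeff

section OperatorBounds

variable {E : Type*} [NormedAddCommGroup E] [InnerProductSpace ℝ E]

/-- A bilinear form bounded by `M (‖v‖² + ‖w‖²) / 2` has norm at most `M`. -/
theorem ContinuousLinearMap.opNorm_le_of_inner_le {B : E →L[ℝ] E} {M : ℝ} (hM : 0 ≤ M)
    (h : ∀ v w, ⟪B v, w⟫ ≤ M * ((‖v‖ ^ 2 + ‖w‖ ^ 2) / 2)) : ‖B‖ ≤ M := by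
  refine B.opNorm_le_bound hM fun v => ?_
  rcases eq_or_ne (B v) 0 with h0 | h0
  · rw [h0, norm_zero]; positivity
  have hpos : 0 < ‖B v‖ := norm_pos_iff.2 h0
  rcases eq_or_ne v 0 with rfl | hv
  · simp
  have hv : 0 < ‖v‖ := norm_pos_iff.2 hv
  -- The test vector `w` is parallel to `B v` and has the length of `v`.
  have key := h v ((‖v‖ / ‖B v‖) • B v)
  rw [inner_smul_right, real_inner_self_eq_norm_sq, norm_smul,
    Real.norm_of_nonneg (by positivity), div_mul_cancel₀ _ hpos.ne'] at key
  have h1 : ‖v‖ / ‖B v‖ * ‖B v‖ ^ 2 = ‖B v‖ * ‖v‖ := by field_simp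
  rw [h1] at key
  refine le_of_mul_le_mul_right ?_ hv
  linarith

/-- Polarization for a symmetric nonnegative operator. -/
theorem ContinuousLinearMap.inner_le_of_symm_of_nonneg {B : E →L[ℝ] E} {M : ℝ}
    (hsymm : ∀ v w, ⟪B v, w⟫ = ⟪v, B w⟫) (hnonneg : ∀ v, 0 ≤ ⟪B v, v⟫)
    (hle : ∀ v, ⟪B v, v⟫ ≤ M * ‖v‖ ^ 2) (v w : E) :
    |⟪B v, w⟫| ≤ M * ((‖v‖ ^ 2 + ‖w‖ ^ 2) / 2) := by
  have h1 := hnonneg (v - w)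
  have h2 := hnonneg (v + w)
  have h3 : ⟪B w, v⟫ = ⟪B v, w⟫ := by rw [hsymm, real_inner_comm]
  simp only [map_sub, map_add, inner_sub_left, inner_sub_right, inner_add_left, inner_add_right,
    h3] at h1 h2
  have h4 := hle v
  have h5 := hle w
  rw [abs_le]
  constructor <;> linarith

theorem ContinuousLinearMap.opNorm_le_of_symm_of_nonneg {B : E →L[ℝ] E} {M : ℝ} (hM : 0 ≤ M)
    (hsymm : ∀ v w, ⟪B v, w⟫ = ⟪v, B w⟫) (hnonneg : ∀ v, 0 ≤ ⟪B v, v⟫)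
    (hle : ∀ v, ⟪B v, v⟫ ≤ M * ‖v‖ ^ 2) : ‖B‖ ≤ M :=
  opNorm_le_of_inner_le hM fun v w =>
    (le_abs_self _).trans (inner_le_of_symm_of_nonneg hsymm hnonneg hle v w)

end OperatorBounds

namespace RiccatiCoeff

variable {E : Type*} [NormedAddCommGroup E] [InnerProductSpace ℝ E] [CompleteSpace E]
  {H : RiccatiCoeff E} {a c q b s t : ℝ} {ξ π : ℝ → E}

theorem IsValueOp.norm_le {R : E →L[ℝ] E} (hR : H.IsValueOp s t R)
    (hH : H.BoundedOn a c q b (Icc s t)) (hst : s ≤ t) : ‖R‖ ≤ upperConst a c q :=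
  ContinuousLinearMap.opNorm_le_of_symm_of_nonneg hH.upperConst_pos.le (hR.inner_symm hH hst)
    (hR.inner_nonneg hH hst) (hR.inner_le hH hst)

/-- The fundamental solution of the Hamiltonian system with `U s = 0`, `V s = 1`. -/
theorem BoundedOn.exists_fundamental (hH : H.BoundedOn a c q b (Icc s t)) (hst : s ≤ t) :
    ∃ U V : ℝ → E →L[ℝ] E, U s = 0 ∧ V s = 1 ∧ ∀ r ∈ Icc s t,
      HasDerivWithinAt U (H.W r * V r - (H.A r).adjoint * U r) (Icc s t) r ∧
      HasDerivWithinAt V (H.A r * V r + H.Q r * U r) (Icc s t) r := by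
  have ha := hH.a_nonneg
  have hc := hH.c_nonneg
  have hb := hH.b_nonneg
  have hA' : ContinuousOn (fun r => (H.A r).adjoint) (Icc s t) :=
    ContinuousLinearMap.adjoint.continuous.comp_continuousOn hH.continuousOn_A
  obtain ⟨α, hα0, hα⟩ := exists_solution_Icc_of_lipschitz
    (F := (E →L[ℝ] E) × (E →L[ℝ] E)) hst (K := ⟨a + b + c, by positivity⟩)
    (f := fun r z => (H.W r * z.2 - (H.A r).adjoint * z.1, H.A r * z.2 + H.Q r * z.1))
    (fun r hr => by
      refine LipschitzWith.of_dist_le_mul fun z w => ?_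
      rw [dist_eq_norm, dist_eq_norm, Prod.mk_sub_mk]
      have hd : ∀ {B C : E →L[ℝ] E} {β γ : ℝ}, ‖B‖ ≤ β → ‖C‖ ≤ γ →
          ‖B * (z - w).2‖ + ‖C * (z - w).1‖ ≤ (β + γ) * ‖z - w‖ := fun {B C β γ} hB hC => by
        have h1 := norm_mul_le B (z - w).2
        have h2 := norm_mul_le C (z - w).1
        have h3 := mul_le_mul hB (norm_snd_le (z - w)) (norm_nonneg _) ((norm_nonneg _).trans hB)
        have h4 := mul_le_mul hC (norm_fst_le (z - w)) (norm_nonneg _) ((norm_nonneg _).trans hC)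
        linarith
      have hadj : ‖(H.A r).adjoint‖ ≤ a := by
        rw [LinearIsometryEquiv.norm_map]
        exact hH.norm_A_le r hr
      refine max_le ?_ ?_
      · have h1 := hd (hH.norm_W_le r hr) hadj
        have h2 := norm_sub_le (H.W r * (z - w).2) ((H.A r).adjoint * (z - w).1)
        have h3 : (c + a) * ‖z - w‖ ≤ (a + b + c) * ‖z - w‖ :=
          mul_le_mul_of_nonneg_right (by linarith) (norm_nonneg _)
        calc _ = ‖H.W r * (z - w).2 - (H.A r).adjoint * (z - w).1‖ := by
              simp only [Prod.snd_sub, Prod.fst_sub, mul_sub]; congr 1; abel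
          _ ≤ _ := h2.trans (h1.trans h3)
      · have h1 := hd (hH.norm_A_le r hr) (hH.norm_Q_le r hr)
        have h2 := norm_add_le (H.A r * (z - w).2) (H.Q r * (z - w).1)
        have h3 : (a + b) * ‖z - w‖ ≤ (a + b + c) * ‖z - w‖ :=
          mul_le_mul_of_nonneg_right (by linarith) (norm_nonneg _)
        calc _ = ‖H.A r * (z - w).2 + H.Q r * (z - w).1‖ := by
              simp only [Prod.snd_sub, Prod.fst_sub, mul_sub]; congr 1; abel
          _ ≤ _ := h2.trans (h1.trans h3))
    (fun r _ => by simp)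
    (fun z => ((hH.continuousOn_W.mul continuousOn_const).sub (hA'.mul continuousOn_const)).prodMk
      ((hH.continuousOn_A.mul continuousOn_const).add (hH.continuousOn_Q.mul continuousOn_const)))
    (0, 1)
  refine ⟨fun r => (α r).1, fun r => (α r).2, by simp [hα0], by simp [hα0], fun r hr => ?_⟩
  exact ⟨(hasFDerivAt_fst (𝕜 := ℝ) (p := α r)).comp_hasDerivWithinAt r (hα r hr),
    (hasFDerivAt_snd (𝕜 := ℝ) (p := α r)).comp_hasDerivWithinAt r (hα r hr)⟩

/-- The Riccati equation with initial value `0` is solvable on `[s, t]`: with the fundamental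
solution `(U, V)` of the Hamiltonian system, `V` is invertible by the backward Grönwall estimate,
and `U V⁻¹` is the solution. -/
theorem BoundedOn.exists_valueFlow [FiniteDimensional ℝ E] (hH : H.BoundedOn a c q b (Icc s t))
    (hst : s ≤ t) :
    ∃ R : ℝ → E →L[ℝ] E, ∀ r ∈ Icc s t, H.IsValueOp s r (R r) ∧
      HasDerivWithinAt R
        (H.W r - (H.A r).adjoint * R r - R r * H.A r - R r * H.Q r * R r) (Icc s t) r := by
  obtain ⟨U, V, hU0, hV0, hUV⟩ := hH.exists_fundamental hst
  have hpair : ∀ w, H.IsHamPair s t (fun r => V r w) (fun r => U r w) := fun w =>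
    { deriv_state := fun r hr => by
        simpa using (hUV r hr).2.clm_apply (hasDerivWithinAt_const r (Icc s t) w)
      deriv_costate := fun r hr => by
        simpa using (hUV r hr).1.clm_apply (hasDerivWithinAt_const r (Icc s t) w)
      costate_left := by simp [hU0] }
  have hunit : ∀ r ∈ Icc s t, IsUnit (V r) := by
    intro r hr
    have hinj : Function.Injective (V r) := by
      refine (injective_iff_map_eq_zero _).2 fun w hw => ?_
      have h := ((hpair w).mono_right hr.2).norm_sq_state_le
        (hH.mono (Icc_subset_Icc_right hr.2)) (left_mem_Icc.2 hr.1)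
      simpa [hU0, hV0, hw] using h
    rw [ContinuousLinearMap.isUnit_iff_bijective]
    exact ⟨hinj, LinearMap.surjective_of_injective (f := (V r).toLinearMap) hinj⟩
  refine ⟨fun r => U r * Ring.inverse (V r), fun r hr => ⟨fun v => ?_, ?_⟩⟩
  · refine ⟨_, _, (hpair (Ring.inverse (V r) v)).mono_right hr.2, ?_, rfl⟩
    change (V r * Ring.inverse (V r)) v = v
    rw [Ring.mul_inverse_cancel _ (hunit r hr)]
    rfl
  · have hinv : HasDerivWithinAt (fun r => Ring.inverse (V r))
        (-(Ring.inverse (V r) * (H.A r * V r + H.Q r * U r) * Ring.inverse (V r))) (Icc s t) r := by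
      have := (hasFDerivAt_ringInverse (𝕜 := ℝ) (hunit r hr).unit).comp_hasDerivWithinAt_of_eq r
        (hUV r hr).2 rfl
      refine this.congr_deriv ?_
      simp [← Ring.inverse_unit]
    refine ((hUV r hr).1.mul hinv).congr_deriv ?_
    have hVV := Ring.mul_inverse_cancel _ (hunit r hr)
    set V' := Ring.inverse (V r)
    calc (H.W r * V r - (H.A r).adjoint * U r) * V'
          + U r * -(V' * (H.A r * V r + H.Q r * U r) * V')
        = H.W r * (V r * V') - (H.A r).adjoint * (U r * V') - (U r * V') * H.A r * (V r * V')
          - (U r * V') * H.Q r * (U r * V') := by noncomm_ring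
      _ = _ := by rw [hVV, mul_one, mul_one]

theorem BoundedOn.exists_isValueOp [FiniteDimensional ℝ E] (hH : H.BoundedOn a c q b (Icc s t))
    (hst : s ≤ t) : ∃ R : E →L[ℝ] E, H.IsValueOp s t R := by
  obtain ⟨R, hR⟩ := hH.exists_valueFlow hst
  exact ⟨R t, (hR t (right_mem_Icc.2 hst)).1⟩

end RiccatiCoeff

/-! ### Reconstructibility, contraction, and the limit of the value operators -/

namespace RiccatiCoeff

variable {E : Type*} [NormedAddCommGroup E] [InnerProductSpace ℝ E]
  {H : RiccatiCoeff E} {a c q b s t τ ε : ℝ} {ξ π : ℝ → E}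

/-- Reconstructibility on the window `[t - τ, t]`: the free motion ending at `v` has output energy
at least `ε ‖v‖²`. -/
def ReconstructsAt (H : RiccatiCoeff E) (τ ε t : ℝ) : Prop :=
  ∀ v, ∃ ζ : ℝ → E, ζ t = v ∧
    (∀ r ∈ Icc (t - τ) t, HasDerivWithinAt ζ (H.A r (ζ r)) (Icc (t - τ) t) r) ∧
    ε * ‖v‖ ^ 2 ≤ ∫ r in (t - τ)..t, ⟪H.W r (ζ r), ζ r⟫

/-- The lower bound for the value operators under reconstructibility on windows of length `τ`. -/
noncomputable def lowerConst (a c q b τ ε : ℝ) : ℝ :=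
  ε / (2 + 2 * c * τ * (Real.exp ((2 * a + 1) * τ) * (b ^ 2 / q)))

theorem BoundedOn.lowerConst_pos {J : Set ℝ} (hH : H.BoundedOn a c q b J) (hτ : 0 < τ)
    (hε : 0 < ε) : 0 < lowerConst a c q b τ ε := by
  have := hH.c_nonneg
  have := hH.q_pos
  unfold lowerConst
  positivity

/-- The rate at which states of the Hamiltonian system decay backward in time. -/
noncomputable def decayRate (a c q b τ ε : ℝ) : ℝ :=
  q * lowerConst a c q b τ ε ^ 2 / upperConst a c q

/-- The constant in the exponential estimate for the difference of two value operators. -/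
noncomputable def contractionConst (a c q b τ ε : ℝ) : ℝ :=
  2 * upperConst a c q ^ 2 / lowerConst a c q b τ ε

/-- Coefficients bounded and reconstructible, with the given constants, for all `t ≤ 0`. -/
structure Admissible (H : RiccatiCoeff E) (a c q b τ ε : ℝ) : Prop where
  boundedOn : H.BoundedOn a c q b (Iic 0)
  τ_pos : 0 < τ
  ε_pos : 0 < ε
  reconstructsAt : ∀ t ≤ 0, H.ReconstructsAt τ ε t

theorem Admissible.boundedOn_Icc (hH : H.Admissible a c q b τ ε) (ht : t ≤ 0) :
    H.BoundedOn a c q b (Icc s t) :=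
  hH.boundedOn.mono fun _ hr => hr.2.trans ht

theorem Admissible.decayRate_pos (hH : H.Admissible a c q b τ ε) :
    0 < decayRate a c q b τ ε := by
  have := hH.boundedOn.q_pos
  have := hH.boundedOn.upperConst_pos
  have := hH.boundedOn.lowerConst_pos hH.τ_pos hH.ε_pos
  unfold decayRate
  positivity

/-- The error bound for value operators over an interval of length `T + τ` tends to zero. -/
theorem Admissible.tendsto_error (hH : H.Admissible a c q b τ ε) :
    Tendsto (fun T : ℝ => contractionConst a c q b τ ε *
      Real.exp (-decayRate a c q b τ ε * T)) atTop (𝓝 0) := by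
  have h1 : Tendsto (fun T : ℝ => -decayRate a c q b τ ε * T) atTop atBot :=
    tendsto_id.const_mul_atTop_of_neg (neg_lt_zero.2 hH.decayRate_pos)
  simpa using (Real.tendsto_exp_atBot.comp h1).const_mul (contractionConst a c q b τ ε)

variable [CompleteSpace E]

/-- The energy is bounded below: the free motion with the same final value differs from `ξ` by a
curve which the backward Grönwall estimate bounds by the energy, so that the output energy of the
free motion is at most a multiple of the energy. -/
theorem IsHamPair.le_energy (h : H.IsHamPair s t ξ π) (hH : H.BoundedOn a c q b (Icc s t))
    (hτ : 0 < τ) (hs : s ≤ t - τ) (hrec : H.ReconstructsAt τ ε t) :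
    lowerConst a c q b τ ε * ‖ξ t‖ ^ 2 ≤ ⟪π t, ξ t⟫ := by
  obtain ⟨ζ, hζt, hζ, hint⟩ := hrec (ξ t)
  have hsub : Icc (t - τ) t ⊆ Icc s t := Icc_subset_Icc_left hs
  have hle : t - τ ≤ t := by linarith
  have hst : s ≤ t := hs.trans hle
  have ha := hH.a_nonneg
  have hc := hH.c_nonneg
  have hq := hH.q_pos
  set V := fun r => ⟪π r, ξ r⟫ with hV
  have hVnonneg : ∀ r ∈ Icc s t, 0 ≤ V r := fun r hr =>
    (h.mono_right hr.2).energy_nonneg (hH.mono (Icc_subset_Icc_right hr.2)) hr.1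
  set D := Real.exp ((2 * a + 1) * τ) * (b ^ 2 / q) with hD
  have hD0 : 0 ≤ D := by positivity
  have hdiff : ∀ r ∈ Icc (t - τ) t, ‖ζ r - ξ r‖ ^ 2 ≤ D * V t := by
    intro r hr
    have hr' : Icc r t ⊆ Icc (t - τ) t := Icc_subset_Icc_left hr.1
    have h1 := h.norm_sq_le_of_driven hH (hsub hr) (e := fun x => ζ x - ξ x)
      (u := fun x => -(H.Q x (π x)))
      (fun x hx => by
        refine (((hζ x (hr' hx)).mono hr').sub
          ((h.deriv_state x (hsub (hr' hx))).mono (hr'.trans hsub))).congr_deriv ?_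
        rw [map_sub]
        abel)
      (fun x hx => by
        rw [norm_neg]
        exact (H.Q x).le_of_opNorm_le (hH.norm_Q_le x (hsub (hr' hx))) _)
    refine h1.trans ?_
    have h2 : Real.exp ((2 * a + 1) * (t - r)) ≤ Real.exp ((2 * a + 1) * τ) := by
      have : t - r ≤ τ := by linarith [hr.1]
      gcongr
    have h3 := hVnonneg r (hsub hr)
    have h4 : 0 ≤ V t := hVnonneg t (right_mem_Icc.2 hst)
    rw [hζt, sub_self, norm_zero, hD, mul_assoc]
    have h5 : V t - V r ≤ V t := by linarith
    have h6 : b ^ 2 / q * (V t - V r) ≤ b ^ 2 / q * V t := by gcongr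
    calc Real.exp ((2 * a + 1) * (t - r)) * (0 ^ 2 + b ^ 2 / q * (V t - V r))
        ≤ Real.exp ((2 * a + 1) * (t - r)) * (b ^ 2 / q * V t) := by
          gcongr
          linarith
      _ ≤ _ := by gcongr
  have hζc : ContinuousOn ζ (Icc (t - τ) t) := fun r hr => (hζ r hr).continuousWithinAt
  have hder : ∀ r ∈ Icc (t - τ) t, HasDerivWithinAt (fun r => 2 * V r + 2 * c * (D * V t) * r)
      (2 * (⟪H.W r (ξ r), ξ r⟫ + ⟪H.Q r (π r), π r⟫) + 2 * c * (D * V t)) (Icc (t - τ) t) r :=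
    fun r hr => (((h.hasDerivWithinAt_energy (hsub hr)).mono hsub).const_mul 2).add
      (((hasDerivAt_id r).const_mul _).congr_deriv (mul_one _)).hasDerivWithinAt
  have hbound := intervalIntegral.integral_le_sub_of_hasDeriv_right_of_le hle
    (φ := fun r => ⟪H.W r (ζ r), ζ r⟫)
    (fun r hr => (hder r hr).continuousWithinAt)
    (fun r hr => (hder r (Ioo_subset_Icc_self hr)).mono_of_mem_nhdsWithin
      (Icc_mem_nhdsGT_of_mem (Ioo_subset_Ico_self hr)))
    ((((hH.continuousOn_W.mono hsub).clm_apply hζc).inner hζc).integrableOn_Icc)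
    (fun r hr => by
      have hr' := Ioo_subset_Icc_self hr
      have h1 := hH.nonneg_W r (hsub hr') (ξ r - (ζ r - ξ r))
      have h2 : ⟪H.W r (ζ r - ξ r), ζ r - ξ r⟫ ≤ c * (D * V t) := by
        refine (real_inner_le_norm _ _).trans ?_
        have h3 := (H.W r).le_of_opNorm_le (hH.norm_W_le r (hsub hr')) (ζ r - ξ r)
        have h4 := mul_le_mul_of_nonneg_left (hdiff r hr') hc
        nlinarith [norm_nonneg (ζ r - ξ r)]
      have h3 : 0 ≤ ⟪H.Q r (π r), π r⟫ :=
        (by positivity : 0 ≤ q * ‖π r‖ ^ 2).trans (hH.le_Q r (hsub hr') _)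
      simp only [inner_sub_left, inner_sub_right, map_sub] at h1 h2
      linarith)
  have h0 := hVnonneg (t - τ) (hsub (left_mem_Icc.2 hle))
  rw [lowerConst, div_mul_eq_mul_div, div_le_iff₀ (by positivity)]
  change ε * ‖ξ t‖ ^ 2 ≤ V t * (2 + 2 * c * τ * D)
  linarith

/-- States of solutions decay exponentially backward in time, because the energy does. -/
theorem IsHamPair.norm_sq_state_le_exp (h : H.IsHamPair s t ξ π) (hH : H.Admissible a c q b τ ε)
    (ht : t ≤ 0) {σ : ℝ} (hs : s ≤ σ - τ) (hσ : σ ≤ t) :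
    ‖ξ σ‖ ^ 2 ≤ Real.exp (-decayRate a c q b τ ε * (t - σ)) *
      (upperConst a c q / lowerConst a c q b τ ε) * ‖ξ t‖ ^ 2 := by
  set p := lowerConst a c q b τ ε with hp
  set M := upperConst a c q with hM
  set γ := decayRate a c q b τ ε with hγ
  have hτ := hH.τ_pos
  have hp0 : 0 < p := hH.boundedOn.lowerConst_pos hτ hH.ε_pos
  have hM0 : 0 < M := hH.boundedOn.upperConst_pos
  have hq := hH.boundedOn.q_pos
  have hsub : Icc σ t ⊆ Icc s t := Icc_subset_Icc_left (by linarith)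
  have hlow : ∀ r ∈ Icc σ t, p * ‖ξ r‖ ^ 2 ≤ ⟪π r, ξ r⟫ := fun r hr =>
    (h.mono_right hr.2).le_energy (hH.boundedOn_Icc (hr.2.trans ht)) hτ
      (by linarith [hr.1]) (hH.reconstructsAt r (hr.2.trans ht))
  have hup : ∀ r ∈ Icc σ t, ⟪π r, ξ r⟫ ≤ M * ‖ξ r‖ ^ 2 := fun r hr =>
    (h.mono_right hr.2).energy_le (hH.boundedOn_Icc (hr.2.trans ht)) (by linarith [hr.1])
  have hexp : ∀ r, HasDerivAt (fun r => Real.exp (-γ * r)) (Real.exp (-γ * r) * -γ) r := fun r =>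
    ((hasDerivAt_id r).const_mul (-γ)).exp.congr_deriv (by simp)
  have key := le_of_hasDerivWithinAt_Icc_nonneg hσ
    (φ := fun r => Real.exp (-γ * r) * ⟪π r, ξ r⟫)
    (fun r hr => (hexp r).hasDerivWithinAt.mul ((h.hasDerivWithinAt_energy (hsub hr)).mono hsub))
    (fun r hr => by
      have hr0 : r ∈ Iic (0 : ℝ) := hr.2.trans ht
      have h1 := hH.boundedOn.nonneg_W r hr0 (ξ r)
      have h2 := hH.boundedOn.le_Q r hr0 (π r)
      have h3 : p * ‖ξ r‖ ≤ ‖π r‖ := by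
        rcases (norm_nonneg (ξ r)).eq_or_lt with h0 | h0
        · rw [← h0, mul_zero]; positivity
        · refine le_of_mul_le_mul_right ?_ h0
          have := (hlow r hr).trans (real_inner_le_norm _ _)
          linarith
      have h4 : γ * ⟪π r, ξ r⟫ ≤ q * ‖π r‖ ^ 2 := by
        have h5 : γ * ⟪π r, ξ r⟫ ≤ γ * (M * ‖ξ r‖ ^ 2) :=
          mul_le_mul_of_nonneg_left (hup r hr) hH.decayRate_pos.le
        have h6 : γ * (M * ‖ξ r‖ ^ 2) = q * (p * ‖ξ r‖) ^ 2 := by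
          rw [hγ, decayRate, ← hp, ← hM]
          field_simp
        have h7 : (p * ‖ξ r‖) ^ 2 ≤ ‖π r‖ ^ 2 := by gcongr
        nlinarith
      have h5 := Real.exp_pos (-γ * r)
      have h6 : 0 ≤ ⟪H.W r (ξ r), ξ r⟫ + ⟪H.Q r (π r), π r⟫ - γ * ⟪π r, ξ r⟫ := by linarith
      have h7 := mul_nonneg h5.le h6
      linarith)
  have hexp' : Real.exp (-γ * (t - σ)) = Real.exp (-γ * t) / Real.exp (-γ * σ) := by
    rw [← Real.exp_sub]; ring_nf
  have h1 := hlow σ (left_mem_Icc.2 hσ)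
  have h2 := hup t (right_mem_Icc.2 hσ)
  have h3 := mul_le_mul_of_nonneg_left h1 (Real.exp_pos (-γ * σ)).le
  have h4 := mul_le_mul_of_nonneg_left h2 (Real.exp_pos (-γ * t)).le
  have h5 : Real.exp (-γ * σ) * (p * ‖ξ σ‖ ^ 2) ≤ Real.exp (-γ * t) * (M * ‖ξ t‖ ^ 2) :=
    h3.trans (key.trans h4)
  have h6 : Real.exp (-γ * (t - σ)) * (M / p) * ‖ξ t‖ ^ 2
      = (Real.exp (-γ * t) * (M * ‖ξ t‖ ^ 2)) / (Real.exp (-γ * σ) * p) := by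
    rw [hexp']
    field_simp
  rw [h6, le_div_iff₀ (by positivity)]
  linarith

theorem IsValueOp.le_inner {R : E →L[ℝ] E} (hR : H.IsValueOp s t R)
    (hH : H.Admissible a c q b τ ε) (ht : t ≤ 0) (hs : s ≤ t - τ) (v : E) :
    lowerConst a c q b τ ε * ‖v‖ ^ 2 ≤ ⟪R v, v⟫ := by
  obtain ⟨ξ, π, h, rfl, hπ⟩ := hR v
  rw [← hπ]
  exact h.le_energy (hH.boundedOn_Icc ht) hH.τ_pos hs (hH.reconstructsAt t ht)

variable [FiniteDimensional ℝ E]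

/-- Value operators for different initial times differ by an exponentially small amount: the
difference is the symplectic form of two solutions, which can be evaluated at the early time `σ`,
where both states are small. -/
theorem IsValueOp.norm_sub_le {s₁ s₂ σ : ℝ} {R₁ R₂ : E →L[ℝ] E} (hR₁ : H.IsValueOp s₁ t R₁)
    (hR₂ : H.IsValueOp s₂ t R₂) (hH : H.Admissible a c q b τ ε) (ht : t ≤ 0)
    (hs₁ : s₁ ≤ σ - τ) (hs₂ : s₂ ≤ σ - τ) (hσ : σ ≤ t) :
    ‖R₁ - R₂‖ ≤ contractionConst a c q b τ ε *
      Real.exp (-decayRate a c q b τ ε * (t - σ)) := by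
  have hτ := hH.τ_pos
  have hp0 := hH.boundedOn.lowerConst_pos hτ hH.ε_pos
  have hM0 := hH.boundedOn.upperConst_pos
  have hs₁σ : s₁ ≤ σ := by linarith
  have hs₂σ : s₂ ≤ σ := by linarith
  have hσ0 : σ ≤ 0 := hσ.trans ht
  refine ContinuousLinearMap.opNorm_le_of_inner_le
    (by unfold contractionConst; positivity) fun v w => ?_
  obtain ⟨ξ₁, π₁, h₁, hξ₁, hπ₁⟩ := hR₁ v
  obtain ⟨ξ₂, π₂, h₂, hξ₂, hπ₂⟩ := hR₂ w
  have hform : ⟪(R₁ - R₂) v, w⟫ = ⟪π₁ σ, ξ₂ σ⟫ - ⟪ξ₁ σ, π₂ σ⟫ := by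
    rw [← (h₁.toIsHamSolution.mono hs₁σ le_rfl).symplectic_eq
      (h₂.toIsHamSolution.mono hs₂σ le_rfl) (hH.boundedOn_Icc ht) hσ, hξ₁, hξ₂, hπ₁, hπ₂,
      _root_.sub_apply, inner_sub_left, hR₂.inner_symm (hH.boundedOn_Icc ht) (hs₂σ.trans hσ)]
  obtain ⟨S₁, hS₁⟩ := (hH.boundedOn_Icc (s := s₁) hσ0).exists_isValueOp hs₁σ
  obtain ⟨S₂, hS₂⟩ := (hH.boundedOn_Icc (s := s₂) hσ0).exists_isValueOp hs₂σ
  have e1 := hS₁.apply_eq (hH.boundedOn_Icc hσ0) hs₁σ (h₁.mono_right hσ)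
  have e2 := hS₂.apply_eq (hH.boundedOn_Icc hσ0) hs₂σ (h₂.mono_right hσ)
  have b1 := ContinuousLinearMap.inner_le_of_symm_of_nonneg
    (hS₁.inner_symm (hH.boundedOn_Icc hσ0) hs₁σ) (hS₁.inner_nonneg (hH.boundedOn_Icc hσ0) hs₁σ)
    (hS₁.inner_le (hH.boundedOn_Icc hσ0) hs₁σ) (ξ₁ σ) (ξ₂ σ)
  have b2 := ContinuousLinearMap.inner_le_of_symm_of_nonneg
    (hS₂.inner_symm (hH.boundedOn_Icc hσ0) hs₂σ) (hS₂.inner_nonneg (hH.boundedOn_Icc hσ0) hs₂σ)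
    (hS₂.inner_le (hH.boundedOn_Icc hσ0) hs₂σ) (ξ₂ σ) (ξ₁ σ)
  rw [e1] at b1
  rw [e2, real_inner_comm] at b2
  have d1 := h₁.norm_sq_state_le_exp hH ht hs₁ hσ
  have d2 := h₂.norm_sq_state_le_exp hH ht hs₂ hσ
  rw [hξ₁] at d1
  rw [hξ₂] at d2
  have b1' := (abs_le.1 b1).2
  have b2' := (abs_le.1 b2).1
  have hsum : ‖ξ₁ σ‖ ^ 2 + ‖ξ₂ σ‖ ^ 2 ≤ Real.exp (-decayRate a c q b τ ε * (t - σ)) *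
      (upperConst a c q / lowerConst a c q b τ ε) * (‖v‖ ^ 2 + ‖w‖ ^ 2) := by linarith
  have hsum' := mul_le_mul_of_nonneg_left hsum hM0.le
  rw [hform]
  calc ⟪π₁ σ, ξ₂ σ⟫ - ⟪ξ₁ σ, π₂ σ⟫
      ≤ upperConst a c q * (‖ξ₁ σ‖ ^ 2 + ‖ξ₂ σ‖ ^ 2) := by linarith
    _ ≤ _ := hsum'
    _ = _ := by
        unfold contractionConst
        field_simp

/-- Value operators depend Lipschitz continuously on the coefficients. -/
theorem IsValueOp.norm_sub_le_of_coeff {H₁ H₂ : RiccatiCoeff E} {R₁ R₂ : E →L[ℝ] E} {δ : ℝ}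
    (hR₁ : H₁.IsValueOp s t R₁) (hR₂ : H₂.IsValueOp s t R₂)
    (hH₁ : H₁.BoundedOn a c q b (Icc s t)) (hH₂ : H₂.BoundedOn a c q b (Icc s t)) (hst : s ≤ t)
    (hA : ∀ r ∈ Icc s t, ‖H₂.A r - H₁.A r‖ ≤ δ) (hW : ∀ r ∈ Icc s t, ‖H₁.W r - H₂.W r‖ ≤ δ)
    (hQ : ∀ r ∈ Icc s t, ‖H₂.Q r - H₁.Q r‖ ≤ δ) :
    ‖R₁ - R₂‖ ≤ (1 + upperConst a c q) ^ 2 * (Real.exp ((2 * a + 1) * (t - s)) *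
      (1 + b ^ 2 / q * upperConst a c q)) * (t - s) * δ := by
  have ha := hH₁.a_nonneg
  have hq := hH₁.q_pos
  have hM0 := hH₁.upperConst_pos
  set M := upperConst a c q with hM
  set G := Real.exp ((2 * a + 1) * (t - s)) * (1 + b ^ 2 / q * M) with hG
  have hG0 : 0 ≤ G := by positivity
  have hδ : 0 ≤ δ := (norm_nonneg _).trans (hA s (left_mem_Icc.2 hst))
  have hts : 0 ≤ t - s := sub_nonneg.2 hst
  have hstate : ∀ {H : RiccatiCoeff E} {ξ π : ℝ → E}, H.BoundedOn a c q b (Icc s t) →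
      H.IsHamPair s t ξ π → ∀ r ∈ Icc s t, ‖ξ r‖ ^ 2 ≤ G * ‖ξ t‖ ^ 2 ∧ ‖π r‖ ≤ M * ‖ξ r‖ := by
    intro H ξ π hH h r hr
    have hHr := hH.mono (Icc_subset_Icc_right hr.2)
    refine ⟨(h.norm_sq_state_le hH hr).trans ?_, ?_⟩
    · have h1 : ⟪π t, ξ t⟫ - ⟪π r, ξ r⟫ ≤ M * ‖ξ t‖ ^ 2 := by
        linarith [h.energy_le hH hst, (h.mono_right hr.2).energy_nonneg hHr hr.1]
      have h2 : t - r ≤ t - s := by linarith [hr.1]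
      calc _ ≤ Real.exp ((2 * a + 1) * (t - r)) * (‖ξ t‖ ^ 2 + b ^ 2 / q * (M * ‖ξ t‖ ^ 2)) := by
            gcongr
        _ ≤ Real.exp ((2 * a + 1) * (t - s)) * (‖ξ t‖ ^ 2 + b ^ 2 / q * (M * ‖ξ t‖ ^ 2)) := by
            gcongr
        _ = _ := by rw [hG]; ring
    · obtain ⟨S, hS⟩ := hHr.exists_isValueOp hr.1
      rw [← hS.apply_eq hHr hr.1 (h.mono_right hr.2)]
      exact S.le_of_opNorm_le (hS.norm_le hHr hr.1) _
  refine ContinuousLinearMap.opNorm_le_of_inner_le (by positivity) fun v w => ?_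
  obtain ⟨ξ₁, π₁, h₁, hξ₁, hπ₁⟩ := hR₁ v
  obtain ⟨ξ₂, π₂, h₂, hξ₂, hπ₂⟩ := hR₂ w
  have hform : ⟪(R₁ - R₂) v, w⟫ = ⟪π₁ t, ξ₂ t⟫ - ⟪ξ₁ t, π₂ t⟫ := by
    rw [hξ₁, hξ₂, hπ₁, hπ₂, _root_.sub_apply, inner_sub_left, hR₂.inner_symm hH₂ hst]
  set N := (1 + M) ^ 2 * G * δ * ((‖v‖ ^ 2 + ‖w‖ ^ 2) / 2) with hN
  have key := le_of_hasDerivWithinAt_Icc_nonneg hst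
    (φ := fun r => N * r - (⟪π₁ r, ξ₂ r⟫ - ⟪ξ₁ r, π₂ r⟫))
    (fun r hr => (((hasDerivAt_id r).const_mul N).hasDerivWithinAt).sub
      (h₁.toIsHamSolution.hasDerivWithinAt_symplectic h₂.toIsHamSolution hH₂.symm_W hH₁.symm_Q hr))
    (fun r hr => by
      obtain ⟨hx1, hp1⟩ := hstate hH₁ h₁ r hr
      obtain ⟨hx2, hp2⟩ := hstate hH₂ h₂ r hr
      rw [hξ₁] at hx1
      rw [hξ₂] at hx2
      have hb : ∀ {B : E →L[ℝ] E}, ‖B‖ ≤ δ → ∀ x y, ⟪B x, y⟫ ≤ δ * ‖x‖ * ‖y‖ := fun {B} hB x y =>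
        (real_inner_le_norm _ _).trans
          (mul_le_mul_of_nonneg_right (B.le_of_opNorm_le hB x) (norm_nonneg _))
      have t1 := hb (hW r hr) (ξ₁ r) (ξ₂ r)
      have t2 := hb (hA r hr) (ξ₂ r) (π₁ r)
      have t3 := hb (hA r hr) (ξ₁ r) (π₂ r)
      have t4 := hb (hQ r hr) (π₂ r) (π₁ r)
      rw [real_inner_comm] at t2 t4
      have hprod : (‖ξ₁ r‖ + ‖π₁ r‖) * (‖ξ₂ r‖ + ‖π₂ r‖)
          ≤ (1 + M) ^ 2 * (G * ((‖v‖ ^ 2 + ‖w‖ ^ 2) / 2)) := by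
        have e1 : ‖ξ₁ r‖ + ‖π₁ r‖ ≤ (1 + M) * ‖ξ₁ r‖ := by linarith
        have e2 : ‖ξ₂ r‖ + ‖π₂ r‖ ≤ (1 + M) * ‖ξ₂ r‖ := by linarith
        have e3 : ‖ξ₁ r‖ * ‖ξ₂ r‖ ≤ G * ((‖v‖ ^ 2 + ‖w‖ ^ 2) / 2) := by
          nlinarith [sq_nonneg (‖ξ₁ r‖ - ‖ξ₂ r‖)]
        calc _ ≤ ((1 + M) * ‖ξ₁ r‖) * ((1 + M) * ‖ξ₂ r‖) := by gcongr
          _ = (1 + M) ^ 2 * (‖ξ₁ r‖ * ‖ξ₂ r‖) := by ring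
          _ ≤ _ := by gcongr
      have hprod' := mul_le_mul_of_nonneg_left hprod hδ
      have hN' : N = δ * ((1 + M) ^ 2 * (G * ((‖v‖ ^ 2 + ‖w‖ ^ 2) / 2))) := by rw [hN]; ring
      rw [mul_one, hN']
      linarith)
  simp only [h₁.costate_left, h₂.costate_left, inner_zero_left, inner_zero_right, sub_zero] at key
  rw [hform]
  have : (1 + M) ^ 2 * G * (t - s) * δ * ((‖v‖ ^ 2 + ‖w‖ ^ 2) / 2) = N * (t - s) := by
    rw [hN]; ring
  rw [this]
  linarith

end RiccatiCoeff

namespace RiccatiCoeff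

variable {E : Type*} [NormedAddCommGroup E] [InnerProductSpace ℝ E] [CompleteSpace E]
  {H : RiccatiCoeff E} {a c q b s t τ ε : ℝ}

/-- `P` is the limit, at the exponential rate of `IsValueOp.norm_sub_le`, of the value operators
on `[s, t]` as `s → -∞`. -/
def IsLimitOp (H : RiccatiCoeff E) (a c q b τ ε t : ℝ) (P : E →L[ℝ] E) : Prop :=
  ∀ s ≤ t - τ, ∀ R, H.IsValueOp s t R → ‖R - P‖ ≤ contractionConst a c q b τ ε *
    Real.exp (-decayRate a c q b τ ε * (t - τ - s))

theorem IsLimitOp.tendsto {P : E →L[ℝ] E} (hP : H.IsLimitOp a c q b τ ε t P)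
    (hH : H.Admissible a c q b τ ε) {R : ℝ → E →L[ℝ] E}
    (hR : ∀ s ≤ t - τ, H.IsValueOp s t (R s)) : Tendsto R atBot (𝓝 P) := by
  rw [tendsto_iff_norm_sub_tendsto_zero]
  refine squeeze_zero' (Eventually.of_forall fun _ => norm_nonneg _) ?_
    (hH.tendsto_error.comp (tendsto_atTop_add_const_left atBot (t - τ) tendsto_neg_atBot_atTop))
  filter_upwards [eventually_le_atBot (t - τ)] with s hs
  exact hP s hs _ (hR s hs)

theorem IsValueOp.of_shift {H₁ H₂ : RiccatiCoeff E} {d : ℝ} {R : E →L[ℝ] E}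
    (hR : H₁.IsValueOp (s + d) (t + d) R)
    (hA : ∀ r ∈ Icc s t, H₂.A r = H₁.A (r + d)) (hW : ∀ r ∈ Icc s t, H₂.W r = H₁.W (r + d))
    (hQ : ∀ r ∈ Icc s t, H₂.Q r = H₁.Q (r + d)) : H₂.IsValueOp s t R := by
  intro v
  obtain ⟨ξ, π, h, hξ, hπ⟩ := hR v
  have hmaps : MapsTo (fun r => r + d) (Icc s t) (Icc (s + d) (t + d)) :=
    fun r hr => ⟨by linarith [hr.1], by linarith [hr.2]⟩
  have hcomp : ∀ {g : ℝ → E} {g' : E} {r : ℝ}, r ∈ Icc s t →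
      HasDerivWithinAt g g' (Icc (s + d) (t + d)) (r + d) →
      HasDerivWithinAt (fun r => g (r + d)) g' (Icc s t) r := fun {g g' r} hr hg => by
    have := hg.scomp r ((hasDerivAt_id r).add_const d).hasDerivWithinAt hmaps
    rwa [one_smul] at this
  refine ⟨fun r => ξ (r + d), fun r => π (r + d), ⟨⟨fun r hr => ?_, fun r hr => ?_⟩, h.costate_left⟩,
    hξ, hπ⟩
  · rw [hA r hr, hQ r hr]
    exact hcomp hr (h.deriv_state _ (hmaps hr))
  · rw [hW r hr, hA r hr]
    exact hcomp hr (h.deriv_costate _ (hmaps hr))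

theorem IsLimitOp.of_shift {H₁ H₂ : RiccatiCoeff E} {d : ℝ} {P : E →L[ℝ] E}
    (hP : H₂.IsLimitOp a c q b τ ε 0 P)
    (hA : ∀ r ≤ 0, H₂.A r = H₁.A (r + d)) (hW : ∀ r ≤ 0, H₂.W r = H₁.W (r + d))
    (hQ : ∀ r ≤ 0, H₂.Q r = H₁.Q (r + d)) : H₁.IsLimitOp a c q b τ ε d P := by
  intro s hs R hR
  have hR' : H₂.IsValueOp (s - d) 0 R := by
    refine IsValueOp.of_shift (H₁ := H₁) (d := d) ?_ (fun r hr => hA r hr.2)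
      (fun r hr => hW r hr.2) (fun r hr => hQ r hr.2)
    rwa [sub_add_cancel, zero_add]
  have := hP (s - d) (by linarith) R hR'
  rwa [show 0 - τ - (s - d) = d - τ - s by ring] at this

variable [FiniteDimensional ℝ E]

theorem Admissible.exists_valueOp_family (hH : H.Admissible a c q b τ ε) (ht : t ≤ 0) :
    ∃ R : ℝ → E →L[ℝ] E, ∀ s ≤ t - τ, H.IsValueOp s t (R s) := by
  have hτ := hH.τ_pos
  have hex : ∀ s, ∃ R : E →L[ℝ] E, s ≤ t - τ → H.IsValueOp s t R := fun s => by
    by_cases hs : s ≤ t - τ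
    · obtain ⟨R, hR⟩ := (hH.boundedOn_Icc (s := s) ht).exists_isValueOp (by linarith)
      exact ⟨R, fun _ => hR⟩
    · exact ⟨0, fun h => absurd h hs⟩
  choose R hR using hex
  exact ⟨R, hR⟩

theorem Admissible.exists_isLimitOp (hH : H.Admissible a c q b τ ε) (ht : t ≤ 0) :
    ∃ P : E →L[ℝ] E, H.IsLimitOp a c q b τ ε t P := by
  have hτ := hH.τ_pos
  obtain ⟨R, hR⟩ := hH.exists_valueOp_family ht
  set err : ℝ → ℝ := fun T => contractionConst a c q b τ ε *
    Real.exp (-decayRate a c q b τ ε * T) with herr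
  have hdiff : ∀ s ≤ t - τ, ∀ s' ≤ s, ∀ S, H.IsValueOp s t S → ‖S - R s'‖ ≤ err (t - τ - s) := by
    intro s hs s' hs' S hS
    have := hS.norm_sub_le (hR s' (hs'.trans hs)) hH ht (σ := s + τ) (by linarith) (by linarith)
      (by linarith)
    rwa [show t - (s + τ) = t - τ - s by ring] at this
  have hcauchy : CauchySeq fun n : ℕ => R (t - τ - n) := by
    refine cauchySeq_of_le_tendsto_0' (fun n : ℕ => err n) (fun n m hnm => ?_)
      (hH.tendsto_error.comp tendsto_natCast_atTop_atTop)
    have hn : (t - τ - n : ℝ) ≤ t - τ := by linarith [Nat.cast_nonneg (α := ℝ) n]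
    have hnm' : (n : ℝ) ≤ m := Nat.cast_le.2 hnm
    rw [dist_eq_norm]
    simpa using hdiff _ hn (t - τ - m) (by linarith) _ (hR _ hn)
  obtain ⟨P, hP⟩ := cauchySeq_tendsto_of_complete hcauchy
  refine ⟨P, fun s hs S hS => ?_⟩
  refine le_of_tendsto (tendsto_const_nhds.sub hP).norm ?_
  obtain ⟨N, hN⟩ := exists_nat_ge (t - τ - s)
  filter_upwards [eventually_ge_atTop N] with n hn
  have hn' : (N : ℝ) ≤ n := Nat.cast_le.2 hn
  exact hdiff s hs _ (by linarith) S hS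

/-- Every closed condition satisfied by all value operators on long intervals passes to the
limit. -/
theorem IsLimitOp.mem_of_isClosed {P : E →L[ℝ] E} (hP : H.IsLimitOp a c q b τ ε t P)
    (hH : H.Admissible a c q b τ ε) (ht : t ≤ 0) {S : Set (E →L[ℝ] E)} (hS : IsClosed S)
    (hmem : ∀ s ≤ t - τ, ∀ R, H.IsValueOp s t R → R ∈ S) : P ∈ S := by
  obtain ⟨R, hR⟩ := hH.exists_valueOp_family ht
  refine hS.mem_of_tendsto (hP.tendsto hH hR) ?_
  filter_upwards [eventually_le_atBot (t - τ)] with s hs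
  exact hmem s hs _ (hR s hs)

theorem IsLimitOp.inner_symm {P : E →L[ℝ] E} (hP : H.IsLimitOp a c q b τ ε t P)
    (hH : H.Admissible a c q b τ ε) (ht : t ≤ 0) (v w : E) : ⟪P v, w⟫ = ⟪v, P w⟫ :=
  hP.mem_of_isClosed hH ht (S := {R | ⟪R v, w⟫ = ⟪v, R w⟫})
    (isClosed_eq (by fun_prop) (by fun_prop))
    (fun _ hs _ hR => hR.inner_symm (hH.boundedOn_Icc ht) (by linarith [hH.τ_pos]) v w)

theorem IsLimitOp.le_inner {P : E →L[ℝ] E} (hP : H.IsLimitOp a c q b τ ε t P)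
    (hH : H.Admissible a c q b τ ε) (ht : t ≤ 0) (v : E) :
    lowerConst a c q b τ ε * ‖v‖ ^ 2 ≤ ⟪P v, v⟫ :=
  hP.mem_of_isClosed hH ht (S := {R | lowerConst a c q b τ ε * ‖v‖ ^ 2 ≤ ⟪R v, v⟫})
    (isClosed_le (by fun_prop) (by fun_prop)) (fun _ hs _ hR => hR.le_inner hH ht hs v)

theorem IsLimitOp.inner_le {P : E →L[ℝ] E} (hP : H.IsLimitOp a c q b τ ε t P)
    (hH : H.Admissible a c q b τ ε) (ht : t ≤ 0) (v : E) :
    ⟪P v, v⟫ ≤ upperConst a c q * ‖v‖ ^ 2 :=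
  hP.mem_of_isClosed hH ht (S := {R | ⟪R v, v⟫ ≤ upperConst a c q * ‖v‖ ^ 2})
    (isClosed_le (by fun_prop) (by fun_prop))
    (fun _ hs _ hR => hR.inner_le (hH.boundedOn_Icc ht) (by linarith [hH.τ_pos]) v)

theorem IsLimitOp.norm_le {P : E →L[ℝ] E} (hP : H.IsLimitOp a c q b τ ε t P)
    (hH : H.Admissible a c q b τ ε) (ht : t ≤ 0) : ‖P‖ ≤ upperConst a c q :=
  hP.mem_of_isClosed hH ht (S := {R | ‖R‖ ≤ upperConst a c q})
    (isClosed_le (by fun_prop) (by fun_prop))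
    (fun _ hs _ hR => hR.norm_le (hH.boundedOn_Icc ht) (by linarith [hH.τ_pos]))

/-- The limit operators satisfy the Riccati equation: the derivatives of the value operators
converge locally uniformly. -/
theorem Admissible.hasDerivAt_of_isLimitOp (hH : H.Admissible a c q b τ ε) {P : ℝ → E →L[ℝ] E}
    (hP : ∀ t ≤ 0, H.IsLimitOp a c q b τ ε t (P t)) (ht : t < 0) :
    HasDerivAt P (H.W t - (H.A t).adjoint * P t - P t * H.A t - P t * H.Q t * P t) t := by
  have hτ := hH.τ_pos
  have ha := hH.boundedOn.a_nonneg
  have hb := hH.boundedOn.b_nonneg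
  have hM0 := hH.boundedOn.upperConst_pos
  have hlow : ∀ n : ℕ, t - 1 - τ - n ≤ 0 := fun n => by
    linarith [Nat.cast_nonneg (α := ℝ) n]
  choose R hR using fun n : ℕ =>
    (hH.boundedOn_Icc (s := t - 1 - τ - n) le_rfl).exists_valueFlow (hlow n)
  have hmem : ∀ (n : ℕ) {r : ℝ}, r ∈ Ioo (t - 1) 0 → r ∈ Icc (t - 1 - τ - n) 0 :=
    fun n {r} hr => ⟨by linarith [hr.1, Nat.cast_nonneg (α := ℝ) n], hr.2.le⟩
  set err : ℝ → ℝ := fun T => contractionConst a c q b τ ε *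
    Real.exp (-decayRate a c q b τ ε * T) with herr
  have hp0 := hH.boundedOn.lowerConst_pos hτ hH.ε_pos
  have hdiff : ∀ (n : ℕ) {r : ℝ}, r ∈ Ioo (t - 1) 0 → ‖R n r - P r‖ ≤ err n := by
    intro n r hr
    refine (hP r hr.2.le _ (by linarith [hr.1, Nat.cast_nonneg (α := ℝ) n]) _
      (hR n r (hmem n hr)).1).trans ?_
    have h1 : (n : ℝ) ≤ r - τ - (t - 1 - τ - n) := by linarith [hr.1]
    have h2 := mul_le_mul_of_nonneg_left h1 hH.decayRate_pos.le
    have h3 : 0 ≤ contractionConst a c q b τ ε := by unfold contractionConst; positivity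
    refine mul_le_mul_of_nonneg_left (Real.exp_le_exp.2 ?_) h3
    linarith
  have herr0 : Tendsto (fun n : ℕ => (2 * a + 2 * upperConst a c q * b) * err n) atTop (𝓝 0) := by
    have := (hH.tendsto_error.comp tendsto_natCast_atTop_atTop).const_mul
      (2 * a + 2 * upperConst a c q * b)
    rwa [mul_zero] at this
  have htmem : t ∈ Ioo (t - 1) 0 := ⟨by linarith, ht⟩
  refine hasDerivAt_of_tendstoUniformlyOn (s := Ioo (t - 1) 0) (l := atTop) (f := R) isOpen_Ioo
    (f' := fun n r => H.W r - (H.A r).adjoint * R n r - R n r * H.A r - R n r * H.Q r * R n r)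
    (g' := fun r => H.W r - (H.A r).adjoint * P r - P r * H.A r - P r * H.Q r * P r)
    ?_ (Eventually.of_forall fun n r hr => (hR n r (hmem n hr)).2.hasDerivAt ?_) ?_ htmem
  · rw [Metric.tendstoUniformlyOn_iff]
    intro δ hδ
    filter_upwards [herr0.eventually (gt_mem_nhds hδ)] with n hn r hr
    refine lt_of_le_of_lt ?_ hn
    have hr0 : r ∈ Iic (0 : ℝ) := hr.2.le
    have hd := hdiff n hr
    have hRn : ‖R n r‖ ≤ upperConst a c q :=
      (hR n r (hmem n hr)).1.norm_le (hH.boundedOn_Icc hr.2.le) (hmem n hr).1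
    have hPn : ‖P r‖ ≤ upperConst a c q := (hP r hr.2.le).norm_le hH hr.2.le
    have hA := hH.boundedOn.norm_A_le r hr0
    have hA' : ‖(H.A r).adjoint‖ ≤ a := by rwa [LinearIsometryEquiv.norm_map]
    have hQ := hH.boundedOn.norm_Q_le r hr0
    have hsplit : (H.W r - (H.A r).adjoint * P r - P r * H.A r - P r * H.Q r * P r)
        - (H.W r - (H.A r).adjoint * R n r - R n r * H.A r - R n r * H.Q r * R n r)
        = (H.A r).adjoint * (R n r - P r) + (R n r - P r) * H.A r
          + (R n r * H.Q r * (R n r - P r) + (R n r - P r) * H.Q r * P r) := by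
      noncomm_ring
    have herrn : 0 ≤ err n := (norm_nonneg _).trans hd
    rw [dist_eq_norm, hsplit]
    have h1 : ‖(H.A r).adjoint * (R n r - P r)‖ ≤ a * err n := norm_mul_le_of_le hA' hd
    have h2 : ‖(R n r - P r) * H.A r‖ ≤ err n * a := norm_mul_le_of_le hd hA
    have h3 : ‖R n r * H.Q r * (R n r - P r)‖ ≤ upperConst a c q * b * err n :=
      norm_mul_le_of_le (norm_mul_le_of_le hRn hQ) hd
    have h4 : ‖(R n r - P r) * H.Q r * P r‖ ≤ err n * b * upperConst a c q :=
      norm_mul_le_of_le (norm_mul_le_of_le hd hQ) hPn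
    have h5 := norm_add₃_le (a := (H.A r).adjoint * (R n r - P r)) (b := (R n r - P r) * H.A r)
      (c := R n r * H.Q r * (R n r - P r) + (R n r - P r) * H.Q r * P r)
    have h6 := norm_add_le (R n r * H.Q r * (R n r - P r)) ((R n r - P r) * H.Q r * P r)
    linarith
  · exact Icc_mem_nhds (by linarith [hr.1, Nat.cast_nonneg (α := ℝ) n]) hr.2
  · intro r hr
    rw [tendsto_iff_norm_sub_tendsto_zero]
    exact squeeze_zero (fun _ => norm_nonneg _) (fun n => hdiff n hr)
      (hH.tendsto_error.comp tendsto_natCast_atTop_atTop)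

end RiccatiCoeff

/-! ### Dependence of backward solutions on the initial value -/

section Flow

variable {F : Type*} [NormedAddCommGroup F] [NormedSpace ℝ F]

/-- A backward solution `X` staying in the open set `Ω` has a tube around it from which no solution
starting close enough to `X 0` can escape, and within which solutions separate at most
exponentially. Neither convexity of `Ω` nor a global Lipschitz constant is needed, because `f` is
compared only on short segments issued from points of `X`. -/
theorem exists_tube_norm_sub_le {f : F → F} {Ω : Set F} (hΩ : IsOpen Ω)
    (hf : DifferentiableOn ℝ f Ω) {K : ℝ} (hK : 0 ≤ K) (hfK : ∀ x ∈ Ω, ‖fderiv ℝ f x‖ ≤ K)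
    {X : ℝ → F} {T : ℝ} (hX : IsIntegralCurveOn X (fun _ => f) (Icc (-T) 0))
    (hXΩ : ∀ t ∈ Icc (-T) 0, X t ∈ Ω) :
    ∃ ρ > 0, ∀ (Y : ℝ → F), IsIntegralCurveOn Y (fun _ => f) (Icc (-T) 0) →
      ∀ δ > 0, δ * Real.exp ((K + 1) * T) ≤ ρ → ‖Y 0 - X 0‖ ≤ δ →
      ∀ t ∈ Icc (-T) 0, ‖Y t - X t‖ ≤ δ * Real.exp ((K + 1) * T) := by
  obtain ⟨ρ, hρ, hthick⟩ := (isCompact_Icc.image_of_continuousOn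
    hX.continuousOn).exists_cthickening_subset_open hΩ (image_subset_iff.2 hXΩ)
  refine ⟨ρ, hρ, fun Y hY δ hδ hδρ h0 => ?_⟩
  have hmaps : MapsTo (fun u : ℝ => -u) (Icc 0 T) (Icc (-T) 0) :=
    fun u hu => ⟨neg_le_neg hu.2, neg_nonpos.2 hu.1⟩
  have hneg : ∀ {Z : ℝ → F}, IsIntegralCurveOn Z (fun _ => f) (Icc (-T) 0) →
      ∀ u ∈ Icc 0 T, HasDerivWithinAt (fun u => Z (-u)) (-f (Z (-u))) (Icc 0 T) u := by
    intro Z hZ u hu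
    have := (hZ _ (hmaps hu)).scomp u (hasDerivAt_neg u).hasDerivWithinAt hmaps
    rwa [neg_one_smul] at this
  have hd : ∀ u ∈ Icc 0 T, HasDerivWithinAt (fun u => Y (-u) - X (-u))
      (-f (Y (-u)) - -f (X (-u))) (Icc 0 T) u := fun u hu => (hneg hY u hu).sub (hneg hX u hu)
  have hexp : ∀ u, HasDerivAt (fun u => δ * Real.exp ((K + 1) * u))
      (δ * (Real.exp ((K + 1) * u) * (K + 1))) u := fun u =>
    (((hasDerivAt_id u).const_mul (K + 1)).exp.congr_deriv (by simp)).const_mul δ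
  have hmono : ∀ u ∈ Icc 0 T, δ * Real.exp ((K + 1) * u) ≤ δ * Real.exp ((K + 1) * T) := by
    intro u hu
    have := hu.2
    gcongr
  have key := image_norm_le_of_norm_deriv_right_lt_deriv_boundary
    (f := fun u => Y (-u) - X (-u)) (a := 0) (b := T)
    (fun u hu => (hd u hu).continuousWithinAt)
    (fun u hu => (hd u (Ico_subset_Icc_self hu)).mono_of_mem_nhdsWithin
      (Icc_mem_nhdsGE_of_mem hu))
    (by simpa using h0) hexp
    (fun u hu heq => by
      have hu' := Ico_subset_Icc_self hu
      have hnorm : ‖Y (-u) - X (-u)‖ ≤ ρ := heq.le.trans ((hmono u hu').trans hδρ)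
      have hball : Metric.closedBall (X (-u)) ρ ⊆ Ω :=
        (Metric.closedBall_subset_cthickening (mem_image_of_mem X (hmaps hu')) ρ).trans hthick
      have hlip := (convex_closedBall (X (-u)) ρ).norm_image_sub_le_of_norm_fderiv_le
        (𝕜 := ℝ) (f := f) (C := K)
        (fun x hx => (hf x (hball hx)).differentiableAt (hΩ.mem_nhds (hball hx)))
        (fun x hx => hfK x (hball hx)) (Metric.mem_closedBall_self hρ.le)
        (mem_closedBall_iff_norm.2 hnorm)
      have h1 : ‖-f (Y (-u)) - -f (X (-u))‖ ≤ K * (δ * Real.exp ((K + 1) * u)) := by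
        rw [← heq, neg_sub_neg, norm_sub_rev]
        exact hlip
      have h2 : 0 < δ * Real.exp ((K + 1) * u) := by positivity
      linarith)
  intro t ht
  have htT : -t ∈ Icc 0 T := ⟨neg_nonneg.2 ht.2, by linarith [ht.1]⟩
  have := (key htT).trans (hmono _ htT)
  simpa using this

/-- Backward solutions are unique as soon as one of them stays in `Ω`. -/
theorem eqOn_of_isIntegralCurveOn_Icc {f : F → F} {Ω : Set F} (hΩ : IsOpen Ω)
    (hf : DifferentiableOn ℝ f Ω) {K : ℝ} (hK : 0 ≤ K) (hfK : ∀ x ∈ Ω, ‖fderiv ℝ f x‖ ≤ K)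
    {X Y : ℝ → F} {T : ℝ} (hX : IsIntegralCurveOn X (fun _ => f) (Icc (-T) 0))
    (hXΩ : ∀ t ∈ Icc (-T) 0, X t ∈ Ω) (hY : IsIntegralCurveOn Y (fun _ => f) (Icc (-T) 0))
    (h0 : Y 0 = X 0) : EqOn Y X (Icc (-T) 0) := by
  obtain ⟨ρ, hρ, htube⟩ := exists_tube_norm_sub_le hΩ hf hK hfK hX hXΩ
  intro t ht
  rw [← sub_eq_zero, ← norm_le_zero_iff]
  refine le_of_forall_gt_imp_ge_of_dense fun η hη => ?_
  have hmin : 0 < min η ρ := lt_min hη hρ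
  have hcancel : min η ρ / Real.exp ((K + 1) * T) * Real.exp ((K + 1) * T) = min η ρ :=
    div_mul_cancel₀ _ (Real.exp_pos _).ne'
  have hpos : 0 < min η ρ / Real.exp ((K + 1) * T) := by positivity
  have := htube Y hY _ hpos (hcancel.le.trans (min_le_right _ _))
    (by rw [h0, sub_self, norm_zero]; exact hpos.le) t ht
  exact (this.trans hcancel.le).trans (min_le_left _ _)

/-- A continuous function of the state varies, over a compact time interval, arbitrarily little
between solutions whose initial values are close. -/
theorem eventually_dist_comp_solution_lt {G : Type*} [PseudoMetricSpace G] {f : F → F} {Ω : Set F}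
    (hΩ : IsOpen Ω) (hf : DifferentiableOn ℝ f Ω) {K : ℝ} (hK : 0 ≤ K)
    (hfK : ∀ x ∈ Ω, ‖fderiv ℝ f x‖ ≤ K) {X : F → ℝ → F}
    (hX : ∀ x ∈ Ω, IsIntegralCurveOn (X x) (fun _ => f) (Iic 0))
    (hXΩ : ∀ x ∈ Ω, ∀ t ∈ Iic (0 : ℝ), X x t ∈ Ω) (hX0 : ∀ x ∈ Ω, X x 0 = x)
    {g : F → G} (hg : ContinuousOn g Ω) {x : F} (hx : x ∈ Ω) (T : ℝ) {δ : ℝ} (hδ : 0 < δ) :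
    ∀ᶠ y in 𝓝[Ω] x, ∀ t ∈ Icc (-T) 0, dist (g (X x t)) (g (X y t)) < δ := by
  have hsub : Icc (-T) (0 : ℝ) ⊆ Iic 0 := fun t ht => ht.2
  have hXx := (hX x hx).mono hsub
  obtain ⟨ρ, hρ, htube⟩ := exists_tube_norm_sub_le hΩ hf hK hfK hXx
    (fun t ht => hXΩ x hx t (hsub ht))
  have hcomp : IsCompact (X x '' Icc (-T) 0) := isCompact_Icc.image_of_continuousOn hXx.continuousOn
  have hunif := hcomp.uniformContinuousAt_of_continuousAt g
    (by
      rintro _ ⟨t, ht, rfl⟩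
      exact hg.continuousAt (hΩ.mem_nhds (hXΩ x hx t (hsub ht))))
    (Metric.dist_mem_uniformity hδ)
  obtain ⟨η, hη, hη'⟩ := Metric.mem_uniformity_dist.1 hunif
  set r := min (η / 2) ρ with hr
  have hr0 : 0 < r := lt_min (by positivity) hρ
  set δ' := r / Real.exp ((K + 1) * T) with hδ'
  have hδ'0 : 0 < δ' := by positivity
  have hcancel : δ' * Real.exp ((K + 1) * T) = r := div_mul_cancel₀ _ (Real.exp_pos _).ne'
  filter_upwards [inter_mem_nhdsWithin Ω (Metric.ball_mem_nhds x hδ'0)] with y hy t ht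
  have h1 := htube (X y) ((hX y hy.1).mono hsub) δ' hδ'0 (hcancel.le.trans (min_le_right _ _))
    (by rw [hX0 x hx, hX0 y hy.1]; exact (mem_ball_iff_norm.1 hy.2).le) t ht
  have h2 : dist (X x t) (X y t) < η := by
    rw [dist_comm, dist_eq_norm]
    have : r ≤ η / 2 := min_le_left _ _
    linarith
  exact hη' h2 (mem_image_of_mem _ ht)

end Flow

/-! ### Matrices as operators on Euclidean space -/

section MatrixOperators

variable {n m : ℕ}

/-- A linear map on matrices is bounded in terms of the absolute values of the entries. -/
theorem LinearMap.exists_norm_le_of_entries {G : Type*} [SeminormedAddCommGroup G] [NormedSpace ℝ G]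
    (L : Matrix (Fin m) (Fin n) ℝ →ₗ[ℝ] G) :
    ∃ K, 0 ≤ K ∧ ∀ (M : Matrix (Fin m) (Fin n) ℝ) (a : ℝ), (∀ i j, |M i j| ≤ a) →
      ‖L M‖ ≤ K * a := by
  refine ⟨∑ i, ∑ j, ‖L (Matrix.single i j 1)‖, by positivity, fun M a hM => ?_⟩
  have hsum : L M = ∑ i, ∑ j, M i j • L (Matrix.single i j 1) := by
    conv_lhs => rw [Matrix.matrix_eq_sum_single M]
    simp only [map_sum, ← map_smul, Matrix.smul_single, smul_eq_mul, mul_one]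
  rw [hsum, Finset.sum_mul]
  refine norm_sum_le_of_le _ fun i _ => ?_
  rw [Finset.sum_mul]
  refine norm_sum_le_of_le _ fun j _ => ?_
  rw [norm_smul, mul_comm, Real.norm_eq_abs]
  exact mul_le_mul_of_nonneg_left (hM i j) (norm_nonneg _)

/-- The operator on Euclidean space given by a square matrix, as a linear function of the
matrix. -/
noncomputable def euclideanOp (n : ℕ) :
    Matrix (Fin n) (Fin n) ℝ →ₗ[ℝ] (EuclideanSpace ℝ (Fin n) →L[ℝ] EuclideanSpace ℝ (Fin n)) :=
  (Matrix.toEuclideanCLM (n := Fin n) (𝕜 := ℝ)).toAlgEquiv.toLinearMap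

theorem euclideanOp_apply (M : Matrix (Fin n) (Fin n) ℝ) :
    euclideanOp n M = Matrix.toEuclideanCLM (𝕜 := ℝ) M := rfl

theorem euclideanOp_apply_toLp (M : Matrix (Fin n) (Fin n) ℝ) (v : Fin n → ℝ) :
    euclideanOp n M (WithLp.toLp 2 v) = WithLp.toLp 2 (M *ᵥ v) := rfl

theorem continuous_euclideanOp : Continuous (euclideanOp n) :=
  LinearMap.continuous_of_finiteDimensional _

theorem inner_toLp_euclideanOp (M : Matrix (Fin n) (Fin n) ℝ) (v w : Fin n → ℝ) :
    ⟪WithLp.toLp 2 v, euclideanOp n M (WithLp.toLp 2 w)⟫ = v ⬝ᵥ (M *ᵥ w) :=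
  Matrix.inner_toEuclideanCLM M _ _

theorem norm_toLp_sq (v : Fin n → ℝ) : ‖WithLp.toLp 2 v‖ ^ 2 = v ⬝ᵥ v := by
  rw [EuclideanSpace.norm_sq_eq]
  simp [dotProduct, sq]

theorem inner_euclideanOp_symm {M : Matrix (Fin n) (Fin n) ℝ} (hM : M.IsSymm)
    (x y : EuclideanSpace ℝ (Fin n)) : ⟪euclideanOp n M x, y⟫ = ⟪x, euclideanOp n M y⟫ := by
  have hstar : star M = M := by
    rw [Matrix.star_eq_conjTranspose, Matrix.conjTranspose_eq_transpose_of_trivial, hM.eq]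
  rw [← ContinuousLinearMap.adjoint_inner_right, ← ContinuousLinearMap.star_eq_adjoint,
    euclideanOp_apply, ← map_star, hstar]

theorem posSemidef_sub_smul_one_iff {M : Matrix (Fin n) (Fin n) ℝ} (hM : M.IsSymm) (k : ℝ) :
    (M - k • (1 : Matrix (Fin n) (Fin n) ℝ)).PosSemidef ↔
      ∀ x : EuclideanSpace ℝ (Fin n), k * ‖x‖ ^ 2 ≤ ⟪euclideanOp n M x, x⟫ := by
  have hherm : (M - k • (1 : Matrix (Fin n) (Fin n) ℝ)).IsHermitian := by
    rw [Matrix.IsHermitian, Matrix.conjTranspose_eq_transpose_of_trivial, Matrix.transpose_sub,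
      Matrix.transpose_smul, Matrix.transpose_one, hM.eq]
  have hform : ∀ v : Fin n → ℝ, v ⬝ᵥ ((M - k • (1 : Matrix (Fin n) (Fin n) ℝ)) *ᵥ v)
      = ⟪euclideanOp n M (WithLp.toLp 2 v), WithLp.toLp 2 v⟫ - k * ‖WithLp.toLp 2 v‖ ^ 2 := by
    intro v
    rw [real_inner_comm, inner_toLp_euclideanOp, norm_toLp_sq, Matrix.sub_mulVec,
      Matrix.smul_mulVec, Matrix.one_mulVec, dotProduct_sub, dotProduct_smul, smul_eq_mul]
  rw [Matrix.posSemidef_iff_dotProduct_mulVec]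
  constructor
  · intro h x
    have := h.2 x.ofLp
    rw [star_trivial, hform, WithLp.toLp_ofLp] at this
    linarith
  · intro h
    refine ⟨hherm, fun v => ?_⟩
    rw [star_trivial, hform]
    linarith [h (WithLp.toLp 2 v)]

theorem posSemidef_smul_one_sub_iff {M : Matrix (Fin n) (Fin n) ℝ} (hM : M.IsSymm) (k : ℝ) :
    (k • (1 : Matrix (Fin n) (Fin n) ℝ) - M).PosSemidef ↔
      ∀ x : EuclideanSpace ℝ (Fin n), ⟪euclideanOp n M x, x⟫ ≤ k * ‖x‖ ^ 2 := by
  have h := posSemidef_sub_smul_one_iff (M := -M) (k := -k) hM.neg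
  rw [show -M - -k • (1 : Matrix (Fin n) (Fin n) ℝ) = k • 1 - M by
    rw [neg_smul]; abel] at h
  rw [h]
  refine forall_congr' fun x => ?_
  rw [map_neg, _root_.neg_apply, inner_neg_left]
  constructor <;> intro h <;> linarith

theorem loewnerBetween_iff {M : Matrix (Fin n) (Fin n) ℝ} (hM : M.IsSymm) (k l : ℝ) :
    LoewnerBetween k l M ↔ ∀ x : EuclideanSpace ℝ (Fin n),
      k * ‖x‖ ^ 2 ≤ ⟪euclideanOp n M x, x⟫ ∧ ⟪euclideanOp n M x, x⟫ ≤ l * ‖x‖ ^ 2 := by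
  rw [LoewnerBetween, posSemidef_sub_smul_one_iff hM, posSemidef_smul_one_sub_iff hM, forall_and]

/-- The matrix of a symmetric operator is symmetric. -/
theorem isSymm_of_inner_symm {M : Matrix (Fin n) (Fin n) ℝ}
    (h : ∀ x y, ⟪euclideanOp n M x, y⟫ = ⟪x, euclideanOp n M y⟫) : M.IsSymm := by
  have hM : (euclideanOp n M).adjoint = euclideanOp n M :=
    (ContinuousLinearMap.eq_adjoint_iff _ _).2 h |>.symm
  rw [← ContinuousLinearMap.star_eq_adjoint, euclideanOp_apply, ← map_star] at hM
  have := (Matrix.toEuclideanCLM (n := Fin n) (𝕜 := ℝ)).injective hM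
  rwa [Matrix.star_eq_conjTranspose, Matrix.conjTranspose_eq_transpose_of_trivial] at this

theorem isSymm_dhTensor (h : (Fin n → ℝ) → (Fin m → ℝ)) (x : Fin n → ℝ) :
    (dhTensor h x).IsSymm := by
  rw [Matrix.IsSymm, dhTensor, Matrix.transpose_mul, Matrix.transpose_transpose]

theorem continuousOn_jacobian {g : (Fin n → ℝ) → (Fin m → ℝ)} {Ω : Set (Fin n → ℝ)}
    (hΩ : IsOpen Ω) (hg : ContDiffOn ℝ 1 g Ω) : ContinuousOn (jacobian g) Ω := by
  let L : ((Fin n → ℝ) →L[ℝ] (Fin m → ℝ)) →ₗ[ℝ] Matrix (Fin m) (Fin n) ℝ :=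
    (LinearMap.toMatrix' (R := ℝ) (m := Fin m) (n := Fin n)).toLinearMap ∘ₗ
      ContinuousLinearMap.coeLM ℝ
  exact (LinearMap.continuous_of_finiteDimensional L).comp_continuousOn
    (hg.continuousOn_fderiv_of_isOpen hΩ le_rfl)

/-- Entrywise bounds on the Jacobian matrix bound the Fréchet derivative. -/
theorem exists_norm_fderiv_le {g : (Fin n → ℝ) → (Fin m → ℝ)} {Ω : Set (Fin n → ℝ)}
    (hg : ∃ a : ℝ, ∀ x ∈ Ω, ∀ i j, |jacobian g x i j| ≤ a) :
    ∃ K, 0 ≤ K ∧ ∀ x ∈ Ω, ‖fderiv ℝ g x‖ ≤ K := by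
  obtain ⟨a, ha⟩ := hg
  let L : Matrix (Fin m) (Fin n) ℝ →ₗ[ℝ] ((Fin n → ℝ) →L[ℝ] (Fin m → ℝ)) :=
    (LinearMap.toContinuousLinearMap (𝕜 := ℝ) (E := Fin n → ℝ) (F' := Fin m → ℝ)).toLinearMap ∘ₗ
      (Matrix.toLin' (R := ℝ) (m := Fin m) (n := Fin n)).toLinearMap
  obtain ⟨K, hK, hL⟩ := L.exists_norm_le_of_entries
  refine ⟨K * |a|, by positivity, fun x hx => ?_⟩
  have hfd : L (jacobian g x) = fderiv ℝ g x := by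
    ext1 v
    simp [L, jacobian]
  rw [← hfd]
  exact hL _ _ fun i j => (ha x hx i j).trans (le_abs_self a)

theorem exists_norm_euclideanOp_le {ι : Type*} {M : ι → Matrix (Fin n) (Fin n) ℝ} {Ω : Set ι}
    (hM : ∃ a : ℝ, ∀ x ∈ Ω, ∀ i j, |M x i j| ≤ a) :
    ∃ K, 0 ≤ K ∧ ∀ x ∈ Ω, ‖euclideanOp n (M x)‖ ≤ K := by
  obtain ⟨a, ha⟩ := hM
  obtain ⟨K, hK, hL⟩ := (euclideanOp n).exists_norm_le_of_entries
  exact ⟨K * |a|, by positivity, fun x hx =>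
    hL _ _ fun i j => (ha x hx i j).trans (le_abs_self a)⟩

theorem exists_abs_dhTensor_le {h : (Fin n → ℝ) → (Fin m → ℝ)} {Ω : Set (Fin n → ℝ)}
    (hh : ∃ c : ℝ, ∀ x ∈ Ω, ∀ i j, |jacobian h x i j| ≤ c) :
    ∃ c : ℝ, ∀ x ∈ Ω, ∀ i j, |dhTensor h x i j| ≤ c := by
  obtain ⟨c, hc⟩ := hh
  refine ⟨∑ _k : Fin m, c * c, fun x hx i j => ?_⟩
  rw [dhTensor, Matrix.mul_apply]
  refine (Finset.abs_sum_le_sum_abs _ _).trans (Finset.sum_le_sum fun k _ => ?_)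
  rw [abs_mul]
  exact mul_le_mul (hc x hx k i) (hc x hx k j) (abs_nonneg _) ((abs_nonneg _).trans (hc x hx k i))

theorem inner_euclideanOp_dhTensor_nonneg (h : (Fin n → ℝ) → (Fin m → ℝ)) (x : Fin n → ℝ)
    (v : EuclideanSpace ℝ (Fin n)) : 0 ≤ ⟪euclideanOp n (dhTensor h x) v, v⟫ := by
  have := inner_toLp_euclideanOp (dhTensor h x) v.ofLp v.ofLp
  rw [WithLp.toLp_ofLp] at this
  rw [real_inner_comm, this, dhTensor, ← Matrix.mulVec_mulVec, Matrix.dotProduct_mulVec,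
    Matrix.vecMul_transpose]
  exact Finset.sum_nonneg fun i _ => mul_self_nonneg _

end MatrixOperators

/-! ### The linearization along backward solutions -/

section Linearization

variable {n p : ℕ} {f : (Fin n → ℝ) → (Fin n → ℝ)} {h : (Fin n → ℝ) → (Fin p → ℝ)}
  {Q : (Fin n → ℝ) → Matrix (Fin n) (Fin n) ℝ} {Ω : Set (Fin n → ℝ)} {X : ℝ → (Fin n → ℝ)}

/-- The coefficients of the Riccati equation along a curve `X`. -/
noncomputable def coeffAlong (f : (Fin n → ℝ) → (Fin n → ℝ)) (h : (Fin n → ℝ) → (Fin p → ℝ))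
    (Q : (Fin n → ℝ) → Matrix (Fin n) (Fin n) ℝ) (X : ℝ → (Fin n → ℝ)) :
    RiccatiCoeff (EuclideanSpace ℝ (Fin n)) where
  A t := euclideanOp n (jacobian f (X t))
  W t := euclideanOp n (dhTensor h (X t))
  Q t := euclideanOp n (Q (X t))

theorem IsBackwardSolution.comp_add {x : Fin n → ℝ} (hX : IsBackwardSolution f Ω x X) {d : ℝ}
    (hd : d ≤ 0) : IsBackwardSolution f Ω (X d) (fun t => X (t + d)) := by
  refine ⟨by simp, ?_, fun t ht => hX.2.2 _ (add_nonpos ht hd)⟩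
  refine (hX.2.1.comp_add d).mono fun t ht => ?_
  rw [Set.mem_vadd_set_iff_neg_vadd_mem, neg_neg, vadd_eq_add]
  exact add_nonpos hd ht

theorem continuousOn_matrix_mul {k l m : ℕ} {T : Type*} [TopologicalSpace T] {S : Set T}
    {M : T → Matrix (Fin k) (Fin l) ℝ} {N : T → Matrix (Fin l) (Fin m) ℝ}
    (hM : ContinuousOn M S) (hN : ContinuousOn N S) : ContinuousOn (fun t => M t * N t) S :=
  (continuous_fst.matrix_mul continuous_snd).comp_continuousOn (hM.prodMk hN)

/-- The quadratic form of the Gramian is the output energy of the free motion. -/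
theorem dotProduct_gramian_mulVec {C : ℝ → Matrix (Fin p) (Fin n) ℝ}
    {Φ : ℝ → Matrix (Fin n) (Fin n) ℝ} {τ : ℝ} (hτ : 0 ≤ τ) (hC : ContinuousOn C (Icc (-τ) 0))
    (hΦ : ContinuousOn Φ (Icc (-τ) 0)) (v : Fin n → ℝ) :
    v ⬝ᵥ (gramian C Φ τ *ᵥ v) =
      ∫ t in (-τ)..0, (Φ t *ᵥ v) ⬝ᵥ (((C t)ᵀ * C t) *ᵥ (Φ t *ᵥ v)) := by
  have hcont : ContinuousOn (fun t => (Φ t)ᵀ * (C t)ᵀ * C t * Φ t) (uIcc (-τ) 0) := by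
    rw [uIcc_of_le (by linarith)]
    have hT : ∀ {k l : ℕ} {M : ℝ → Matrix (Fin k) (Fin l) ℝ}, ContinuousOn M (Icc (-τ) 0) →
        ContinuousOn (fun t => (M t)ᵀ) (Icc (-τ) 0) :=
      fun hM => (continuous_id.matrix_transpose).comp_continuousOn hM
    exact continuousOn_matrix_mul (continuousOn_matrix_mul
      (continuousOn_matrix_mul (hT hΦ) (hT hC)) hC) hΦ
  have hentry : ∀ i j, ContinuousOn (fun t => v i * (((Φ t)ᵀ * (C t)ᵀ * C t * Φ t) i j * v j))
      (uIcc (-τ) 0) := fun i j => continuousOn_const.mul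
    ((((continuous_apply j).comp (continuous_apply i)).comp_continuousOn hcont).mul
      continuousOn_const)
  have hpt : ∀ t, (Φ t *ᵥ v) ⬝ᵥ (((C t)ᵀ * C t) *ᵥ (Φ t *ᵥ v))
      = ∑ i, ∑ j, v i * (((Φ t)ᵀ * (C t)ᵀ * C t * Φ t) i j * v j) := by
    intro t
    have : (Φ t *ᵥ v) ⬝ᵥ (((C t)ᵀ * C t) *ᵥ (Φ t *ᵥ v))
        = v ⬝ᵥ (((Φ t)ᵀ * (C t)ᵀ * C t * Φ t) *ᵥ v) := by
      rw [Matrix.dotProduct_mulVec, Matrix.dotProduct_mulVec v, Matrix.dotProduct_mulVec,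
        Matrix.vecMul_vecMul, ← Matrix.vecMul_transpose, Matrix.vecMul_vecMul]
      simp only [Matrix.mul_assoc]
    rw [this]
    simp only [dotProduct, Matrix.mulVec, Finset.mul_sum]
  simp_rw [hpt]
  rw [intervalIntegral.integral_finsetSum fun i _ =>
    (continuousOn_finsetSum _ fun j _ => hentry i j).intervalIntegrable]
  simp only [dotProduct, Matrix.mulVec, Finset.mul_sum, gramian, Matrix.of_apply]
  refine Finset.sum_congr rfl fun i _ => ?_
  rw [intervalIntegral.integral_finsetSum fun j _ => (hentry i j).intervalIntegrable]
  refine Finset.sum_congr rfl fun j _ => ?_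
  rw [intervalIntegral.integral_const_mul, intervalIntegral.integral_mul_const]

theorem reconstructsAt_coeffAlong {τ ε : ℝ} (hτ : 0 < τ) {x : Fin n → ℝ}
    (hX : IsBackwardSolution f Ω x X) (hC : ContinuousOn (jacobian h) Ω)
    (hrec : ∀ x ∈ Ω, ∀ X : ℝ → (Fin n → ℝ), IsBackwardSolution f Ω x X →
      ∃ Φ : ℝ → Matrix (Fin n) (Fin n) ℝ, IsTransitionMatrix (fun t => jacobian f (X t)) Φ ∧
        (gramian (fun t => jacobian h (X t)) Φ τ
          - ε • (1 : Matrix (Fin n) (Fin n) ℝ)).PosSemidef) {t : ℝ} (ht : t ≤ 0) :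
    (coeffAlong f h Q X).ReconstructsAt τ ε t := by
  have hXt := hX.comp_add ht
  obtain ⟨Φ, ⟨hΦ0, hΦ⟩, hG⟩ := hrec (X t) (hX.2.2 t ht) _ hXt
  intro v
  have hsub : Icc (-τ) (0 : ℝ) ⊆ Iic 0 := fun r hr => hr.2
  have hmaps : MapsTo (fun r => r - t) (Icc (t - τ) t) (Iic 0) := fun r hr => sub_nonpos.2 hr.2
  have hΦc : ContinuousOn Φ (Icc (-τ) 0) :=
    continuousOn_pi.2 fun i => continuousOn_pi.2 fun j => fun r hr =>
      ((hΦ r (hsub hr) i j).continuousWithinAt).mono hsub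
  have hCc : ContinuousOn (fun r => jacobian h (X (r + t))) (Icc (-τ) 0) :=
    (hC.comp hXt.2.1.continuousOn fun r hr => hXt.2.2 r hr).mono hsub
  refine ⟨fun r => WithLp.toLp 2 (Φ (r - t) *ᵥ v.ofLp), ?_, fun r hr => ?_, ?_⟩
  · simp [hΦ0]
  · have hder : HasDerivWithinAt (fun r => Φ (r - t) *ᵥ v.ofLp)
        (jacobian f (X r) *ᵥ (Φ (r - t) *ᵥ v.ofLp)) (Icc (t - τ) t) r := by
      rw [hasDerivWithinAt_pi]
      intro i
      rw [Matrix.mulVec_mulVec]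
      simp only [Matrix.mulVec, dotProduct]
      refine HasDerivWithinAt.fun_sum fun j _ => ?_
      have h0 := hΦ (r - t) (hmaps hr) i j
      simp only [sub_add_cancel] at h0
      have h1 := h0.scomp r ((hasDerivAt_id r).sub_const t).hasDerivWithinAt hmaps
      rw [one_smul] at h1
      exact h1.mul_const _
    exact ((PiLp.continuousLinearEquiv 2 ℝ fun _ : Fin n => ℝ).symm.hasFDerivAt).comp_hasDerivWithinAt
      r hder
  · have hquad : ε * ‖v‖ ^ 2
        ≤ v.ofLp ⬝ᵥ (gramian (fun r => jacobian h (X (r + t))) Φ τ *ᵥ v.ofLp) := by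
      have := ((Matrix.posSemidef_iff_dotProduct_mulVec.1 hG).2 v.ofLp)
      rw [star_trivial, Matrix.sub_mulVec, Matrix.smul_mulVec, Matrix.one_mulVec, dotProduct_sub,
        dotProduct_smul, smul_eq_mul, ← norm_toLp_sq, WithLp.toLp_ofLp] at this
      linarith
    refine hquad.trans (le_of_eq ?_)
    rw [dotProduct_gramian_mulVec hτ.le hCc hΦc]
    have hshift := intervalIntegral.integral_comp_sub_right (a := t - τ) (b := t)
      (fun r => (Φ r *ᵥ v.ofLp) ⬝ᵥ
        (((jacobian h (X (r + t)))ᵀ * jacobian h (X (r + t))) *ᵥ (Φ r *ᵥ v.ofLp))) t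
    rw [sub_self, show t - τ - t = -τ by ring] at hshift
    rw [← hshift]
    refine intervalIntegral.integral_congr fun r _ => ?_
    simp only [coeffAlong, sub_add_cancel]
    rw [real_inner_comm, inner_toLp_euclideanOp]
    rfl

/-- All backward solutions give rise to admissible coefficients, with common constants. -/
theorem exists_admissible_coeffAlong (hΩ : IsOpen Ω)
    (hf : ContDiffOn ℝ 1 f Ω) (hh : ContDiffOn ℝ 1 h Ω)
    (hQ_cont : ContinuousOn Q Ω) (hQ_symm : ∀ x ∈ Ω, (Q x).IsSymm)
    (hrec : Reconstructible f h Ω)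
    (hf_bdd : ∃ a : ℝ, ∀ x ∈ Ω, ∀ i j, |jacobian f x i j| ≤ a)
    (hh_bdd : ∃ c : ℝ, ∀ x ∈ Ω, ∀ i j, |jacobian h x i j| ≤ c)
    (hQ_bdd : ∃ q₁ q₂ : ℝ, 0 < q₁ ∧ ∀ x ∈ Ω, LoewnerBetween q₁ q₂ (Q x)) :
    ∃ a c q b τ ε : ℝ, 0 < τ ∧ 0 < ε ∧
      ∀ x X, IsBackwardSolution f Ω x X → (coeffAlong f h Q X).Admissible a c q b τ ε := by
  obtain ⟨τ, ε, hτ, hε, hrec⟩ := hrec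
  obtain ⟨a, ha, hfa⟩ := exists_norm_euclideanOp_le hf_bdd
  obtain ⟨c, hc, hhc⟩ := exists_norm_euclideanOp_le (exists_abs_dhTensor_le hh_bdd)
  obtain ⟨q, b, hq, hQ⟩ := hQ_bdd
  refine ⟨a, c, q, |b|, τ, ε, hτ, hε, fun x X hX => ?_⟩
  have hXc : ContinuousOn X (Iic 0) := hX.2.1.continuousOn
  have hcomp : ∀ {M : (Fin n → ℝ) → Matrix (Fin n) (Fin n) ℝ}, ContinuousOn M Ω →
      ContinuousOn (fun t => euclideanOp n (M (X t))) (Iic 0) := fun hM =>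
    continuous_euclideanOp.comp_continuousOn (hM.comp hXc fun t ht => hX.2.2 t ht)
  have hJh := continuousOn_jacobian hΩ hh
  have hQ' : ∀ x ∈ Ω, ∀ v : EuclideanSpace ℝ (Fin n), q * ‖v‖ ^ 2 ≤ ⟪euclideanOp n (Q x) v, v⟫ ∧
      ⟪euclideanOp n (Q x) v, v⟫ ≤ b * ‖v‖ ^ 2 := fun x hx =>
    (loewnerBetween_iff (hQ_symm x hx) q b).1 (hQ x hx)
  refine ⟨⟨ha, hc, hq, abs_nonneg b, hcomp (continuousOn_jacobian hΩ hf),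
    hcomp (continuousOn_matrix_mul (continuous_id.matrix_transpose.comp_continuousOn hJh) hJh), hcomp hQ_cont,
    fun t ht => hfa _ (hX.2.2 t ht), fun t ht => hhc _ (hX.2.2 t ht), fun t ht => ?_,
    fun t _ => inner_euclideanOp_symm (isSymm_dhTensor h _),
    fun t ht => inner_euclideanOp_symm (hQ_symm _ (hX.2.2 t ht)),
    fun t _ => inner_euclideanOp_dhTensor_nonneg h _,
    fun t ht v => (hQ' _ (hX.2.2 t ht) v).1⟩, hτ, hε,
    fun t ht => reconstructsAt_coeffAlong hτ hX hJh hrec ht⟩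
  refine ContinuousLinearMap.opNorm_le_of_symm_of_nonneg (abs_nonneg b)
    (inner_euclideanOp_symm (hQ_symm _ (hX.2.2 t ht)))
    (fun v => (by positivity : 0 ≤ q * ‖v‖ ^ 2).trans (hQ' _ (hX.2.2 t ht) v).1)
    (fun v => ((hQ' _ (hX.2.2 t ht) v).2).trans ?_)
  exact mul_le_mul_of_nonneg_right (le_abs_self b) (sq_nonneg _)

end Linearization

/-! ### The Lie derivative -/

section LieDerivative

variable {n p : ℕ} {f : (Fin n → ℝ) → (Fin n → ℝ)} {h : (Fin n → ℝ) → (Fin p → ℝ)}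
  {Q : (Fin n → ℝ) → Matrix (Fin n) (Fin n) ℝ} {Ω : Set (Fin n → ℝ)}

/-- If along every solution through `x` the tensor `P` has derivative `L - Jᵀ P - P J`, where `J` is
the Jacobian matrix of `f`, then `L` is its Lie derivative. -/
theorem hasLieDerivativeAt_of_hasDerivAt {P : (Fin n → ℝ) → Matrix (Fin n) (Fin n) ℝ}
    {L : Matrix (Fin n) (Fin n) ℝ} {x : Fin n → ℝ} (hf : ContDiffAt ℝ 1 f x) (hL : L.IsSymm)
    (hP : ∀ Y : ℝ → (Fin n → ℝ), Y 0 = x → IsIntegralCurveAt Y (fun _ => f) 0 →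
      HasDerivAt (fun t => euclideanOp n (P (Y t)))
        (euclideanOp n L - (euclideanOp n (jacobian f x)).adjoint * euclideanOp n (P x)
          - euclideanOp n (P x) * euclideanOp n (jacobian f x)) 0) :
    HasLieDerivativeAt f P L x := by
  refine ⟨hL, ?_, fun Y hY0 hY v => ?_⟩
  · obtain ⟨α, hα0, δ, hδ, hα⟩ :=
      hf.exists_forall_mem_closedBall_exists_eq_forall_mem_Ioo_hasDerivAt₀ 0
    exact ⟨α, hα0, eventually_of_mem (Ioo_mem_nhds (by linarith) (by linarith)) hα⟩
  · set J := euclideanOp n (jacobian f x) with hJ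
    set w : EuclideanSpace ℝ (Fin n) := WithLp.toLp 2 v with hw
    have hu : HasDerivAt (fun t : ℝ => w + t • J w) (J w) 0 := by
      have := ((hasDerivAt_id (0 : ℝ)).smul_const (J w)).const_add w
      rwa [one_smul] at this
    have hφ := hu.inner ℝ ((hP Y hY0 hY).clm_apply hu)
    have hvec : ∀ t : ℝ, WithLp.toLp 2 ((1 + t • jacobian f x) *ᵥ v) = w + t • J w := by
      intro t
      rw [Matrix.add_mulVec, Matrix.one_mulVec, Matrix.smul_mulVec, hw, hJ, euclideanOp_apply_toLp]
      rfl
    have hφ' : ∀ t : ℝ, ⟪w + t • J w, euclideanOp n (P (Y t)) (w + t • J w)⟫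
        = ((1 + t • jacobian f x) *ᵥ v) ⬝ᵥ (P (Y t) *ᵥ ((1 + t • jacobian f x) *ᵥ v)) := by
      intro t
      rw [← hvec, inner_toLp_euclideanOp]
    have h0 : ⟪w + (0 : ℝ) • J w, euclideanOp n (P (Y 0)) (w + (0 : ℝ) • J w)⟫
        = v ⬝ᵥ (P x *ᵥ v) := by
      rw [hφ', hY0, zero_smul, add_zero, Matrix.one_mulVec]
    have hlim := hasDerivAt_iff_tendsto_slope_zero.1 hφ
    have hval : v ⬝ᵥ (L *ᵥ v) = ⟪w, euclideanOp n L w⟫ := (inner_toLp_euclideanOp L v v).symm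
    rw [hval]
    refine (hlim.congr fun t => ?_).trans_eq ?_
    · rw [zero_add, h0, hφ', smul_eq_mul, inv_mul_eq_div]
    · congr 1
      have h1 : ⟪w, (J.adjoint * euclideanOp n (P x)) w⟫ = ⟪J w, euclideanOp n (P x) w⟫ :=
        ContinuousLinearMap.adjoint_inner_right J w (euclideanOp n (P x) w)
      have h2 : ⟪w, (euclideanOp n (P x) * J) w⟫ = ⟪w, euclideanOp n (P x) (J w)⟫ := rfl
      simp only [zero_smul, add_zero, hY0, _root_.sub_apply, inner_add_right, inner_sub_right, h1,
        h2]
      ring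

end LieDerivative

/-! ### The limit tensor on `Ω` -/

section LimitTensor

variable {n p : ℕ} {f : (Fin n → ℝ) → (Fin n → ℝ)} {h : (Fin n → ℝ) → (Fin p → ℝ)}
  {Q : (Fin n → ℝ) → Matrix (Fin n) (Fin n) ℝ} {Ω : Set (Fin n → ℝ)}
  {X : (Fin n → ℝ) → ℝ → (Fin n → ℝ)} {a c q b τ ε K : ℝ}
  {R : (Fin n → ℝ) → EuclideanSpace ℝ (Fin n) →L[ℝ] EuclideanSpace ℝ (Fin n)}

/-- The value operators over a fixed time interval depend continuously on the initial point of the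
backward solution, because the coefficients do so uniformly on that interval. -/
theorem continuousOn_valueOp (hΩ : IsOpen Ω) (hf : ContDiffOn ℝ 1 f Ω) (hh : ContDiffOn ℝ 1 h Ω)
    (hQ_cont : ContinuousOn Q Ω) (hK : 0 ≤ K) (hfK : ∀ x ∈ Ω, ‖fderiv ℝ f x‖ ≤ K)
    (hX : ∀ x ∈ Ω, IsBackwardSolution f Ω x (X x))
    (hadm : ∀ x ∈ Ω, (coeffAlong f h Q (X x)).Admissible a c q b τ ε) {T : ℝ} (hT : 0 ≤ T)
    (hR : ∀ x ∈ Ω, (coeffAlong f h Q (X x)).IsValueOp (-T) 0 (R x)) : ContinuousOn R Ω := by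
  intro x hx
  have hJh := continuousOn_jacobian hΩ hh
  have ha := (hadm x hx).boundedOn.a_nonneg
  have hq := (hadm x hx).boundedOn.q_pos
  have hM := (hadm x hx).boundedOn.upperConst_pos
  set C : ℝ := (1 + RiccatiCoeff.upperConst a c q) ^ 2 * (Real.exp ((2 * a + 1) * (0 - -T)) *
      (1 + b ^ 2 / q * RiccatiCoeff.upperConst a c q)) * (0 - -T) with hC
  have hC0 : 0 ≤ C := by
    have : 0 ≤ 0 - -T := by linarith
    positivity
  have hev : ∀ {M : (Fin n → ℝ) → Matrix (Fin n) (Fin n) ℝ}, ContinuousOn M Ω → ∀ {δ : ℝ}, 0 < δ →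
      ∀ᶠ y in 𝓝[Ω] x, ∀ t ∈ Icc (-T) 0,
        ‖euclideanOp n (M (X x t)) - euclideanOp n (M (X y t))‖ < δ := fun {M} hM {δ} hδ => by
    simpa only [dist_eq_norm, Function.comp_apply] using eventually_dist_comp_solution_lt hΩ
      (hf.differentiableOn one_ne_zero) hK hfK (fun y hy => (hX y hy).2.1)
      (fun y hy => (hX y hy).2.2) (fun y hy => (hX y hy).1)
      (continuous_euclideanOp.comp_continuousOn hM) hx T hδ
  refine Metric.tendsto_nhds.2 fun η hη => ?_
  have hδ : 0 < η / (C + 1) := by positivity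
  filter_upwards [hev (continuousOn_jacobian hΩ hf) hδ, hev (M := dhTensor h)
    (continuousOn_matrix_mul (continuous_id.matrix_transpose.comp_continuousOn hJh) hJh) hδ,
    hev hQ_cont hδ, self_mem_nhdsWithin] with y hA hW hQ hy
  have hle := (hR x hx).norm_sub_le_of_coeff (hR y hy) ((hadm x hx).boundedOn_Icc le_rfl)
    ((hadm y hy).boundedOn_Icc le_rfl) (neg_nonpos.2 hT) (δ := η / (C + 1))
    (fun t ht => (norm_sub_rev _ _).trans_le (hA t ht).le) (fun t ht => (hW t ht).le)
    (fun t ht => (norm_sub_rev _ _).trans_le (hQ t ht).le)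
  rw [dist_comm, dist_eq_norm]
  refine hle.trans_lt ?_
  change C * (η / (C + 1)) < η
  rw [mul_div_assoc', div_lt_iff₀ (by positivity)]
  linarith

/-- The limit of the value operators is continuous, as a uniform limit of continuous functions. -/
theorem continuousOn_limitOp (hΩ : IsOpen Ω) (hf : ContDiffOn ℝ 1 f Ω) (hh : ContDiffOn ℝ 1 h Ω)
    (hQ_cont : ContinuousOn Q Ω) (hK : 0 ≤ K) (hfK : ∀ x ∈ Ω, ‖fderiv ℝ f x‖ ≤ K)
    (hX : ∀ x ∈ Ω, IsBackwardSolution f Ω x (X x))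
    (hadm : ∀ x ∈ Ω, (coeffAlong f h Q (X x)).Admissible a c q b τ ε)
    (hR : ∀ x ∈ Ω, (coeffAlong f h Q (X x)).IsLimitOp a c q b τ ε 0 (R x)) :
    ContinuousOn R Ω := by
  rcases Ω.eq_empty_or_nonempty with rfl | ⟨x₀, hx₀⟩
  · exact continuousOn_empty _
  have hτ := (hadm x₀ hx₀).τ_pos
  have hex : ∀ (k : ℕ) x, ∃ S, x ∈ Ω →
      (coeffAlong f h Q (X x)).IsValueOp (-(k + τ)) 0 S := fun k x => by
    by_cases hx : x ∈ Ω
    · obtain ⟨S, hS⟩ := ((hadm x hx).boundedOn_Icc (s := -(k + τ)) le_rfl).exists_isValueOp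
        (neg_nonpos.2 (by positivity))
      exact ⟨S, fun _ => hS⟩
    · exact ⟨0, fun hx' => absurd hx' hx⟩
  choose S hS using hex
  have hlim : TendstoUniformlyOn S R atTop Ω := by
    rw [Metric.tendstoUniformlyOn_iff]
    intro η hη
    filter_upwards [((hadm x₀ hx₀).tendsto_error.comp tendsto_natCast_atTop_atTop).eventually
      (gt_mem_nhds hη)] with k hk x hx
    rw [dist_comm, dist_eq_norm]
    have := hR x hx _ (by linarith [Nat.cast_nonneg (α := ℝ) k]) _ (hS k x hx)
    rw [show 0 - τ - -((k : ℝ) + τ) = k by ring] at this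
    exact this.trans_lt hk
  exact hlim.continuousOn (Frequently.of_forall fun k =>
    continuousOn_valueOp hΩ hf hh hQ_cont hK hfK hX hadm (by positivity) (hS k))

/-- Along solutions through points of `Ω` the limit operators satisfy the Riccati equation. The
solution is regarded as the end piece of the backward solution from a later point `Y d`. -/
theorem hasDerivAt_limitOp_comp (hΩ : IsOpen Ω) (hf : DifferentiableOn ℝ f Ω) (hK : 0 ≤ K)
    (hfK : ∀ x ∈ Ω, ‖fderiv ℝ f x‖ ≤ K) (hX : ∀ x ∈ Ω, IsBackwardSolution f Ω x (X x))
    (hadm : ∀ x ∈ Ω, (coeffAlong f h Q (X x)).Admissible a c q b τ ε)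
    (hR : ∀ x ∈ Ω, (coeffAlong f h Q (X x)).IsLimitOp a c q b τ ε 0 (R x))
    {x : Fin n → ℝ} (hx : x ∈ Ω) {Y : ℝ → (Fin n → ℝ)} (hY0 : Y 0 = x)
    (hY : IsIntegralCurveAt Y (fun _ => f) 0) :
    HasDerivAt (fun t => R (Y t))
      (euclideanOp n (dhTensor h x) - (euclideanOp n (jacobian f x)).adjoint * R x
        - R x * euclideanOp n (jacobian f x) - R x * euclideanOp n (Q x) * R x) 0 := by
  have hYΩ : ∀ᶠ t in 𝓝 (0 : ℝ), Y t ∈ Ω :=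
    hY.hasDerivAt.continuousAt.eventually_mem (hΩ.mem_nhds (by rwa [hY0]))
  obtain ⟨r, hr, hball⟩ := Metric.eventually_nhds_iff.1 (hYΩ.and hY)
  have hnear : ∀ t, |t| < r → Y t ∈ Ω ∧ HasDerivAt Y (f (Y t)) t := fun t ht =>
    hball (by rwa [Real.dist_0_eq_abs])
  set d := r / 3 with hd
  have hd0 : 0 < d := by positivity
  have hydΩ : Y d ∈ Ω := (hnear d (by rw [abs_of_pos hd0]; linarith)).1
  have hXd := hX (Y d) hydΩ
  have hwin : ∀ t ∈ Icc (-(2 * d)) 0, |t + d| < r := fun t ht => by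
    rw [abs_lt]
    constructor <;> linarith [ht.1, ht.2]
  -- Near time `0`, the solution `Y` is the backward solution from `Y d`, delayed by `d`.
  have heq : EqOn (fun t => Y (t + d)) (X (Y d)) (Icc (-(2 * d)) 0) := by
    refine eqOn_of_isIntegralCurveOn_Icc hΩ hf hK hfK (hXd.2.1.mono fun t ht => ht.2)
      (fun t ht => hXd.2.2 t ht.2) (fun t ht => ?_) (by simp [hXd.1])
    have := (hnear _ (hwin t ht)).2.scomp t ((hasDerivAt_id t).add_const d)
    rw [one_smul] at this
    exact this.hasDerivWithinAt
  -- Values of `R` along a backward solution are the limit operators of that solution.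
  have hlimit : ∀ t ≤ 0, (coeffAlong f h Q (X (Y d))).IsLimitOp a c q b τ ε t (R (X (Y d) t)) := by
    intro t ht
    have hXtΩ := hXd.2.2 t ht
    have hsame : ∀ u ≤ 0, X (X (Y d) t) u = X (Y d) (u + t) := by
      intro u hu
      have hcurve := hX _ hXtΩ
      have hcurve' := hXd.comp_add ht
      exact eqOn_of_isIntegralCurveOn_Icc hΩ hf hK hfK (T := -u)
        (hcurve'.2.1.mono fun v hv => hv.2) (fun v hv => hcurve'.2.2 v hv.2)
        (hcurve.2.1.mono fun v hv => hv.2) (hcurve.1.trans hcurve'.1.symm)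
        ⟨by simp, hu⟩
    refine (hR _ hXtΩ).of_shift (fun u hu => ?_) (fun u hu => ?_) (fun u hu => ?_) <;>
      simp only [coeffAlong, hsame u hu]
  have hder := (hadm _ hydΩ).hasDerivAt_of_isLimitOp hlimit (t := -d) (neg_lt_zero.2 hd0)
  have hXx : X (Y d) (-d) = x := by
    rw [← heq ⟨by linarith, by linarith⟩]
    simp only [neg_add_cancel, hY0]
  simp only [coeffAlong, hXx] at hder
  have hder' : HasDerivAt (fun t => R (X (Y d) (t - d)))
      (euclideanOp n (dhTensor h x) - (euclideanOp n (jacobian f x)).adjoint * R x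
        - R x * euclideanOp n (jacobian f x) - R x * euclideanOp n (Q x) * R x) 0 := by
    have := HasDerivAt.scomp_of_eq (0 : ℝ) hder ((hasDerivAt_id (0 : ℝ)).sub_const d) (by simp)
    rwa [one_smul] at this
  refine hder'.congr_of_eventuallyEq ?_
  filter_upwards [Ioo_mem_nhds (neg_lt_zero.2 hd0) hd0] with t ht
  rw [← heq ⟨by linarith [ht.1], by linarith [ht.2]⟩]
  simp only [sub_add_cancel]

end LimitTensor

theorem proposition3 {n p : ℕ}
    (f : (Fin n → ℝ) → (Fin n → ℝ)) (h : (Fin n → ℝ) → (Fin p → ℝ))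
    (Q : (Fin n → ℝ) → Matrix (Fin n) (Fin n) ℝ)
    (Ω : Set (Fin n → ℝ)) (hΩ : IsOpen Ω)
    (hf : ContDiffOn ℝ 1 f Ω) (hh : ContDiffOn ℝ 1 h Ω)
    (hQ_cont : ContinuousOn Q Ω) (hQ_symm : ∀ x ∈ Ω, (Q x).IsSymm)
    (hback : BackwardInvariant f Ω)
    (hrec : Reconstructible f h Ω)
    (hf_bdd : ∃ a : ℝ, ∀ x ∈ Ω, ∀ i j, |jacobian f x i j| ≤ a)
    (hh_bdd : ∃ c : ℝ, ∀ x ∈ Ω, ∀ i j, |jacobian h x i j| ≤ c)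
    (hQ_bdd : ∃ q₁ q₂ : ℝ, 0 < q₁ ∧ ∀ x ∈ Ω, LoewnerBetween q₁ q₂ (Q x)) :
    ∃ P : (Fin n → ℝ) → Matrix (Fin n) (Fin n) ℝ,
      (∀ x ∈ Ω, (P x).IsSymm) ∧
      ContinuousOn P Ω ∧
      (∀ x ∈ Ω, HasLieDerivativeAt f P (dhTensor h x - P x * Q x * P x) x) ∧
      ∃ p₁ p₂ : ℝ, 0 < p₁ ∧ 0 < p₂ ∧ ∀ x ∈ Ω, LoewnerBetween p₁ p₂ (P x) := by
  obtain ⟨a, c, q, b, τ, ε, hτ, hε, hadm⟩ := exists_admissible_coeffAlong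
    hΩ hf hh hQ_cont hQ_symm hrec hf_bdd hh_bdd hQ_bdd
  obtain ⟨K, hK, hfK⟩ := exists_norm_fderiv_le hf_bdd
  have hfd : DifferentiableOn ℝ f Ω := hf.differentiableOn one_ne_zero
  have hback' : ∀ x, ∃ Z, x ∈ Ω → IsBackwardSolution f Ω x Z := fun x => by
    by_cases hx : x ∈ Ω
    · obtain ⟨Z, hZ⟩ := hback x hx
      exact ⟨Z, fun _ => hZ⟩
    · exact ⟨fun _ => 0, fun hx' => absurd hx' hx⟩
  choose X hX using hback'
  have hadm' : ∀ x ∈ Ω, (coeffAlong f h Q (X x)).Admissible a c q b τ ε := fun x hx =>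
    hadm x _ (hX x hx)
  have hex : ∀ x, ∃ R : EuclideanSpace ℝ (Fin n) →L[ℝ] EuclideanSpace ℝ (Fin n), x ∈ Ω →
      (coeffAlong f h Q (X x)).IsLimitOp a c q b τ ε 0 R := by
    intro x
    by_cases hx : x ∈ Ω
    · obtain ⟨R, hR⟩ := (hadm' x hx).exists_isLimitOp le_rfl
      exact ⟨R, fun _ => hR⟩
    · exact ⟨0, fun hx' => absurd hx' hx⟩
  choose R hR using hex
  set P : (Fin n → ℝ) → Matrix (Fin n) (Fin n) ℝ := fun x =>
    (Matrix.toEuclideanCLM (n := Fin n) (𝕜 := ℝ)).symm (R x) with hPdef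
  have hPR : ∀ x, euclideanOp n (P x) = R x := fun x =>
    (Matrix.toEuclideanCLM (n := Fin n) (𝕜 := ℝ)).apply_symm_apply (R x)
  have hsymm : ∀ x ∈ Ω, (P x).IsSymm := fun x hx => isSymm_of_inner_symm fun v w => by
    rw [hPR]
    exact (hR x hx).inner_symm (hadm' x hx) le_rfl v w
  refine ⟨P, hsymm, ?_, fun x hx => ?_, ?_⟩
  · have hcont : Continuous fun S : EuclideanSpace ℝ (Fin n) →L[ℝ] EuclideanSpace ℝ (Fin n) =>
        (Matrix.toEuclideanCLM (n := Fin n) (𝕜 := ℝ)).symm S :=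
      LinearMap.continuous_of_finiteDimensional
        (Matrix.toEuclideanCLM (n := Fin n) (𝕜 := ℝ)).symm.toAlgEquiv.toLinearMap
    exact hcont.comp_continuousOn
      (continuousOn_limitOp hΩ hf hh hQ_cont hK hfK hX hadm' hR)
  · have hL : (dhTensor h x - P x * Q x * P x).IsSymm := by
      rw [Matrix.IsSymm, Matrix.transpose_sub, Matrix.transpose_mul, Matrix.transpose_mul,
        (isSymm_dhTensor h x).eq, (hsymm x hx).eq, (hQ_symm x hx).eq, Matrix.mul_assoc]
    refine hasLieDerivativeAt_of_hasDerivAt (hf.contDiffAt (hΩ.mem_nhds hx)) hL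
      fun Y hY0 hY => ?_
    have hLop : euclideanOp n (dhTensor h x - P x * Q x * P x)
        = euclideanOp n (dhTensor h x) - R x * euclideanOp n (Q x) * R x := by
      rw [map_sub, ← hPR x]
      simp only [euclideanOp_apply, map_mul]
    simp only [hPR]
    rw [hLop]
    refine (hasDerivAt_limitOp_comp hΩ hfd hK hfK hX hadm' hR hx hY0 hY).congr_deriv ?_
    abel
  · by_cases hne : Ω.Nonempty
    · obtain ⟨x₀, hx₀⟩ := hne
      have hb₀ := (hadm' x₀ hx₀).boundedOn
      refine ⟨RiccatiCoeff.lowerConst a c q b τ ε, RiccatiCoeff.upperConst a c q,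
        hb₀.lowerConst_pos hτ hε, hb₀.upperConst_pos, fun x hx => ?_⟩
      rw [loewnerBetween_iff (hsymm x hx)]
      intro v
      rw [hPR]
      exact ⟨(hR x hx).le_inner (hadm' x hx) le_rfl v,
        (hR x hx).inner_le (hadm' x hx) le_rfl v⟩
    · exact ⟨1, 1, one_pos, one_pos, fun x hx => absurd ⟨x, hx⟩ hne⟩
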